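/- **Conventions.** A graph on $n$ vertices is a directed multigraph $G=(V,E)$ with $V=\{1,\dots,n\}$ and $E$ a finite multiset of pairs $(u,v)\in V\times V$ with $u\neq v$. For $x:V\to\{0,1\}$ let $\mathrm{val}_G(x)$ be the fraction of the edges $(u,v)\in E$, counted with multiplicity, with $x(u)=1$ and $x(v)=0$ (and $\mathrm{val}_G(x)=0$ if $E=\emptyset$), and let $\mathrm{maxval}(G)=\max_{x}\mathrm{val}_G(x)$. A randomized streaming algorithm for $n$-vertex graphs that uses $P$ passes consists of a finite set $M$ of memory states, a random initial state, a randomized update $M\times(V\times V)\to M$ that is applied (with fresh randomness) whenever an edge arrives, a randomized update $M\to M$ that is applied at the end of each of the $P$ passes, and an output function $M\to\mathbb R$ that is applied to the final state. The updates are the same throughout the run, so that everything the algorithm remembers, including counters and earlier coin tosses, is part of its memory state. Its space is $\lceil\log_2|M|\rceil$, the number of bits needed to store a memory state. In each pass every edge of $G$ arrives exactly once per copy, in an arbitrary (adversarial) order, which may differ from pass to pass. **Theorem.** There is an $\varepsilon_0>0$ such that for every $0<\varepsilon<\varepsilon_0$ there is a randomized streaming algorithm (that is, one such algorithm $A_n$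 for every number $n$ of vertices) with the following properties for every $n$. It uses at most $200/\varepsilon$ passes and at most $\varepsilon^{-10^5/\varepsilon}\cdot\log n$ bits of space ($\log$ is the natural logarithm). For every directed multigraph $G$ on $n$ vertices, with no bound on the degrees, that has at most $n^{1/\varepsilon}$ edges counted with multiplicity (in particular, when $\varepsilon\le 1/C$, for every $G$ with at most $n^{C}$ edges), and for all orders in which the edges of $G$ arrive in the passes, its output $\mathsf{CutEst}$ satisfies $$\Pr\left(\left(\tfrac12-\varepsilon\right)\cdot\mathrm{maxval}(G)\;\le\;\mathsf{CutEst}\;\le\;\mathrm{maxval}(G)\right)\;\ge\;\frac{9}{10}.$$ -/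

import Mathlib

/-- A directed multigraph on the vertex set `Fin n`, without self-loops. -/
structure DiMultigraph (n : ℕ) where
  edges : Multiset (Fin n × Fin n)
  loopless : ∀ e ∈ edges, e.1 ≠ e.2

namespace DiMultigraph

variable {n : ℕ}

/-- The fraction of edges `(u, v)`, counted with multiplicity, such that `x u = 1` and `x v = 0`.
For the graph without edges this is `0`. -/
noncomputable def cutValue (G : DiMultigraph n) (x : Fin n → Bool) : ℝ :=
  (G.edges.countP (fun e => x e.1 = true ∧ x e.2 = false) : ℝ) / (Multiset.card G.edges : ℝ)

/-- The value of the maximum directed cut. -/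
noncomputable def maxval (G : DiMultigraph n) : ℝ :=
  Finset.univ.sup' Finset.univ_nonempty G.cutValue

end DiMultigraph

/-- A randomized multi-pass streaming algorithm for graphs on the vertex set `Fin n`.
Everything that the algorithm remembers between two stream events (the arrival of an edge or
the end of a pass), including a pass counter, an edge counter or earlier coin tosses, if it wants
them, is part of its memory state; each transition uses fresh randomness. -/
structure StreamingAlgorithm (n : ℕ) where
  /-- memory configurations -/
  State : Type
  [fintypeState : Fintype State]
  /-- number of passes -/
  passes : ℕ
  /-- initial memory configuration -/
  init : PMF State
  /-- update of the memory when an edge arrives -/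
  step : State → Fin n × Fin n → PMF State
  /-- update of the memory at the end of a pass -/
  endPass : State → PMF State
  /-- the value that is output after the last pass -/
  output : State → ℝ

namespace StreamingAlgorithm

variable {n : ℕ}

attribute [instance] fintypeState

/-- The number of bits needed to store a memory configuration. -/
def space (A : StreamingAlgorithm n) : ℕ :=
  Nat.clog 2 (Fintype.card A.State)

/-- Process the edges of one pass, in the given order. -/
noncomputable def readEdges (A : StreamingAlgorithm n) :
    List (Fin n × Fin n) → A.State → PMF A.State
  | [], s => PMF.pure s
  | e :: l, s => (A.step s e).bind (A.readEdges l)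

/-- Process a list of passes, each given by the sequence of edges that arrive in it. -/
noncomputable def readPasses (A : StreamingAlgorithm n) :
    List (List (Fin n × Fin n)) → A.State → PMF A.State
  | [], s => PMF.pure s
  | p :: ps, s => ((A.readEdges p s).bind A.endPass).bind (A.readPasses ps)

/-- The distribution of the output on the given passes. -/
noncomputable def outputDist (A : StreamingAlgorithm n)
    (ps : List (List (Fin n × Fin n))) : PMF ℝ :=
  (A.init.bind (A.readPasses ps)).map A.output

end StreamingAlgorithm

/-! The cut is a parallel form of the double greedy algorithm for submodular maximization. Colour
the vertices at random with about `99 / ε` colours and ignore monochromatic edges; each edge is lost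
with probability `1 / k` (`expect_color_eq`). Vertices of one colour no longer interact, so double
greedy can treat the colour classes in order, and the recursion has depth only `k`. At `v` it
compares the gain `a` of adding `v` when later vertices are out with the gain `b` of removing `v`
when later vertices are in, and puts `v` into the cut with probability `ratio a b`. The loss of the
optimum at `v` is at most half the mean gain (`ratio_ineq`). The gains telescope from the empty and
the full cut, both of value zero, which gives half the optimum (`edge_ineq`, `bicolored_le`).

The gains are estimated from sampled edges at `v`, recursively for their endpoints. To keep errors
from compounding over the levels, the fractional cut `frac` is defined as the mean of the estimator
itself. The gains are affine in each endpoint value and the subtrees of a sampled edge are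
independent, so every estimate is unbiased for `frac` (`expect_addGain`, `expect_slot`). Only the
sampling error of one level enters at each vertex (`vertex_ineq`), and the value of the fractional
cut is again estimated without bias (`expect_valueEst_sub_sq_le`).

A level of the tree costs two passes, one to count the eligible edges and one to select among them
(`map_run_const`). A seed uniform below `N!` is uniform modulo every positive `d ≤ N`, and
reordering passes only permutes the seeds (`exists_equiv_fill`). The colouring and the seeds are too
long to store, so Newman's argument (`exists_seeds_card_bad_le`) replaces them by a fixed short list
that works for all graphs and all orders of the passes; the memory holds an index into it. The
required failure bound is `expect_bad_le`. -/

open scoped BigOperators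

/-! ### Averages over finite product spaces and sample means. -/

namespace Fintype

theorem expect_prod {α β : Type*} [Fintype α] [Fintype β] (f : α × β → ℝ) :
    𝔼 x, f x = 𝔼 a, 𝔼 b, f (a, b) := by
  rw [← Finset.univ_product_univ, Finset.expect_product]

theorem expect_comp_fst {α β : Type*} [Fintype α] [Fintype β] [Nonempty β] (f : α → ℝ) :
    𝔼 x : α × β, f x.1 = 𝔼 a, f a := by
  rw [expect_prod]
  exact Finset.expect_congr rfl fun a _ => Fintype.expect_const (ι := β) (f a)

theorem expect_comp_snd {α β : Type*} [Fintype α] [Fintype β] [Nonempty α] (f : β → ℝ) :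
    𝔼 x : α × β, f x.2 = 𝔼 b, f b := by
  rw [expect_prod]
  exact Fintype.expect_const (ι := α) (𝔼 b, f b)

theorem expect_mul_prod {α β : Type*} [Fintype α] [Fintype β] (f : α → ℝ) (g : β → ℝ) :
    𝔼 x : α × β, f x.1 * g x.2 = (𝔼 a, f a) * 𝔼 b, g b := by
  rw [expect_prod, Finset.expect_mul_expect]

theorem expect_pi_succ {S : Type*} [Fintype S] (D : ℕ) (f : (Fin (D + 1) → S) → ℝ) :
    𝔼 ω, f ω = 𝔼 x : S × (Fin D → S), f (Fin.cons x.1 x.2) :=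
  (Fintype.expect_equiv (Fin.consEquiv fun _ : Fin (D + 1) => S) _ _ fun _ => rfl).symm

/-- The coordinates are independent and centred, so the cross terms vanish. -/
theorem expect_pi_sum_sq {S : Type*} [Fintype S] [Nonempty S] (Y : S → ℝ) (hY : 𝔼 x, Y x = 0)
    (D : ℕ) : 𝔼 ω : Fin D → S, (∑ i, Y (ω i)) ^ 2 = D * 𝔼 x, Y x ^ 2 := by
  induction D with
  | zero => simp
  | succ D ih =>
    rw [expect_pi_succ]
    simp only [Fin.sum_univ_succ, Fin.cons_zero, Fin.cons_succ, add_sq]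
    rw [Finset.expect_add_distrib, Finset.expect_add_distrib,
      expect_comp_fst (fun x => Y x ^ 2), expect_comp_snd (fun ω : Fin D → S => (∑ i, Y (ω i)) ^ 2), ih,
      expect_mul_prod (fun x => 2 * Y x) (fun ω : Fin D → S => ∑ i, Y (ω i)), ← Finset.mul_expect, hY]
    push_cast; ring

/-- Chebyshev's estimate for the second moment of the deviation of a sample mean. -/
theorem expect_sampleMean_sub_sq_le {S : Type*} [Fintype S] [Nonempty S] (Y : S → ℝ)
    (hY : ∀ x, |Y x| ≤ 1) {D : ℕ} (hD : 0 < D) {μ : ℝ} (hμ : 𝔼 x, Y x = μ) :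
    𝔼 ω : Fin D → S, (𝔼 i, Y (ω i) - μ) ^ 2 ≤ 1 / D := by
  have hD' : (0 : ℝ) < D := by exact_mod_cast hD
  have h0 : 𝔼 x, (Y x - μ) = 0 := by
    rw [Finset.expect_sub_distrib, hμ, Fintype.expect_const, sub_self]
  have h1 : 𝔼 x, (Y x - μ) ^ 2 ≤ 1 := by
    have : ∀ x, (Y x - μ) ^ 2 = Y x ^ 2 + (-2 * μ) * Y x + μ ^ 2 := fun x => by ring
    simp only [this]
    rw [Finset.expect_add_distrib, Finset.expect_add_distrib, ← Finset.mul_expect, hμ,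
      Fintype.expect_const]
    have : 𝔼 x, Y x ^ 2 ≤ 1 := Finset.expect_le Finset.univ_nonempty fun x _ => by
      have := hY x
      rw [← sq_abs]; exact pow_le_one₀ (abs_nonneg _) this
    nlinarith [sq_nonneg μ]
  have h2 : ∀ ω : Fin D → S, (𝔼 i, Y (ω i) - μ) ^ 2 = (∑ i, (Y (ω i) - μ)) ^ 2 * (1 / D ^ 2) := by
    intro ω
    rw [Fintype.expect_eq_sum_div_card, Finset.sum_sub_distrib]
    simp
    field_simp
  simp only [h2]
  rw [← Finset.expect_mul, expect_pi_sum_sq (fun x => Y x - μ) h0]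
  calc _ ≤ (D : ℝ) * 1 * (1 / D ^ 2) := by gcongr
    _ = 1 / D := by field_simp

theorem expect_abs_sampleMean_sub_le {S : Type*} [Fintype S] [Nonempty S] (Y : S → ℝ)
    (hY : ∀ x, |Y x| ≤ 1) {H : ℕ} (hH : 0 < H) {μ : ℝ} (hμ : 𝔼 x, Y x = μ) :
    𝔼 ω : Fin (H ^ 2) → S, |𝔼 i, Y (ω i) - μ| ≤ 1 / H := by
  have hH' : (0 : ℝ) < H := by exact_mod_cast hH
  have h := expect_sampleMean_sub_sq_le Y hY (pow_pos hH 2) hμ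
  push_cast at h
  -- The bound `y ≤ 1 / (2H) + H y² / 2` balances both terms when the second moment is `1 / H²`.
  have key : ∀ ω : Fin (H ^ 2) → S, |𝔼 i, Y (ω i) - μ| ≤
      (1 / (2 * H) : ℝ) + (𝔼 i, Y (ω i) - μ) ^ 2 * (H / 2) := by
    intro ω
    rw [← sq_abs]
    set y := |𝔼 i, Y (ω i) - μ|
    have : (1 / (2 * H) : ℝ) + y ^ 2 * (H / 2) - y = (1 - H * y) ^ 2 / (2 * H) := by
      field_simp; ring
    have h3 : 0 ≤ (1 - H * y) ^ 2 / (2 * H) := by positivity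
    linarith
  calc _ ≤ _ := Finset.expect_le_expect fun ω _ => key ω
    _ = 1 / (2 * H) + (𝔼 ω : Fin (H ^ 2) → S, (𝔼 i, Y (ω i) - μ) ^ 2) * (H / 2) := by
      rw [Finset.expect_add_distrib, Fintype.expect_const, Finset.expect_mul]
    _ ≤ 1 / (2 * H) + (1 / H ^ 2) * (H / 2) := by gcongr
    _ = 1 / H := by field_simp; norm_num

end Fintype

/-! ### Reduction of the randomness. -/

/-- Newman's argument: if every input is bad for few of the seeds, then there is a short list of
seeds such that every input is bad for at most a tenth of the list. -/
theorem exists_seeds_card_bad_le {Ω B : Type*} [Fintype Ω] [Nonempty Ω] [Fintype B]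
    (bad : B → Ω → Prop) [∀ b ω, Decidable (bad b ω)]
    (h : ∀ b, 𝔼 ω, (if bad b ω then (1 : ℝ) else 0) ≤ 1 / 40)
    (b : ℕ) (hb : Fintype.card B < 2 ^ b) :
    ∃ s : Fin (25 * b) → Ω, ∀ x, 10 * (Finset.univ.filter fun i => bad x (s i)).card ≤ 25 * b := by
  classical
  by_contra! hcon
  have hΩ : (0 : ℝ) < Fintype.card Ω := by exact_mod_cast Fintype.card_pos
  -- Exponential moment with weight `z` per bad seed. A tenth of the list being bad yields `(5/4)`
  -- to the length of the list, while one random seed contributes at most `1 + (z - 1) / 40 ≤ 1.21`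
  -- on average.
  let z : ℝ := (5 / 4) ^ 10
  have hz : z = (5 / 4) ^ 10 := rfl
  have hsum : ∀ x, ∑ s : Fin (25 * b) → Ω, ∏ i, (if bad x (s i) then z else 1) ≤
      (Fintype.card Ω * 1.21) ^ (25 * b) := by
    intro x
    rw [← Fintype.piFinset_univ, ← Finset.prod_univ_sum (fun _ => Finset.univ)
      (fun _ ω => if bad x ω then z else 1)]
    rw [Finset.prod_const, Finset.card_univ, Fintype.card_fin]
    have h1 := h x
    rw [Fintype.expect_eq_sum_div_card, div_le_iff₀ hΩ] at h1
    have h2 : ∑ ω, (if bad x ω then z else 1) =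
        ∑ ω, ((z - 1) * (if bad x ω then (1 : ℝ) else 0) + 1) :=
      Finset.sum_congr rfl fun ω _ => by split_ifs <;> ring
    have h3 : 0 ≤ ∑ ω, (if bad x ω then z else 1) :=
      Finset.sum_nonneg fun ω _ => by split_ifs <;> norm_num [hz]
    refine pow_le_pow_left₀ h3 ?_ _
    rw [h2, Finset.sum_add_distrib, ← Finset.mul_sum, Finset.sum_const, Finset.card_univ,
      nsmul_eq_mul]
    have : (z - 1) * (∑ ω, (if bad x ω then (1 : ℝ) else 0)) ≤
        (z - 1) * (1 / 40 * Fintype.card Ω) :=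
      mul_le_mul_of_nonneg_left h1 (by rw [hz]; norm_num)
    have h4 : (z - 1) / 40 + 1 ≤ 1.21 := by rw [hz]; norm_num
    nlinarith
  have hlow : ∀ s : Fin (25 * b) → Ω, (5 / 4 : ℝ) ^ (25 * b) ≤
      ∑ x, ∏ i, (if bad x (s i) then z else 1) := by
    intro s
    obtain ⟨x, hx⟩ := hcon s
    have h1 : ∏ i, (if bad x (s i) then z else 1) =
        (5 / 4 : ℝ) ^ (10 * (Finset.univ.filter fun i => bad x (s i)).card) := by
      rw [Finset.prod_ite]; simp [hz, pow_mul]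
    calc (5 / 4 : ℝ) ^ (25 * b) ≤ ∏ i, (if bad x (s i) then z else 1) := by
          rw [h1]; exact pow_le_pow_right₀ (by norm_num) hx.le
      _ ≤ _ := Finset.single_le_sum
          (f := fun x => ∏ i, (if bad x (s i) then z else 1))
          (fun y _ => Finset.prod_nonneg fun i _ => by split_ifs <;> norm_num [hz])
          (Finset.mem_univ x)
  have h1 : (Fintype.card Ω : ℝ) ^ (25 * b) * (5 / 4 : ℝ) ^ (25 * b) ≤
      Fintype.card B * (Fintype.card Ω * 1.21) ^ (25 * b) := by
    calc _ = ∑ _s : Fin (25 * b) → Ω, (5 / 4 : ℝ) ^ (25 * b) := by simp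
      _ ≤ ∑ s : Fin (25 * b) → Ω, ∑ x, ∏ i, (if bad x (s i) then z else 1) :=
          Finset.sum_le_sum fun s _ => hlow s
      _ = ∑ x, ∑ s : Fin (25 * b) → Ω, ∏ i, (if bad x (s i) then z else 1) := Finset.sum_comm
      _ ≤ ∑ _x : B, ((Fintype.card Ω : ℝ) * 1.21) ^ (25 * b) := Finset.sum_le_sum fun x _ => hsum x
      _ = _ := by simp
  have h2 : (5 / 4 : ℝ) ^ (25 * b) ≤ Fintype.card B * 1.21 ^ (25 * b) := by
    rw [mul_pow, mul_left_comm] at h1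
    exact le_of_mul_le_mul_left h1 (pow_pos hΩ _)
  -- The length factor `25` is chosen so that `(1.25 / 1.21) ^ 25 ≥ 2`, which beats the union bound
  -- over fewer than `2 ^ b` inputs.
  have h3 : (2 : ℝ) ^ b * 1.21 ^ (25 * b) ≤ (5 / 4 : ℝ) ^ (25 * b) := by
    rw [pow_mul, pow_mul, ← mul_pow]
    exact pow_le_pow_left₀ (by norm_num) (by norm_num) _
  have h4 : (Fintype.card B : ℝ) < 2 ^ b := by exact_mod_cast hb
  have h5 : (0 : ℝ) < 1.21 ^ (25 * b) := by positivity
  nlinarith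

/-! ### Trees of samples. -/

/-- Trees of depth `j` whose inner nodes have `D` labelled slots with two subtrees each, and one
further subtree. -/
def Tower (α : Type) (D : ℕ) : ℕ → Type
  | 0 => Unit
  | j + 1 => Tower α D j × (Fin D → α × (Tower α D j × Tower α D j))

namespace Tower

variable {α β : Type} {D : ℕ}

instance instFintype [Fintype α] : ∀ j, Fintype (Tower α D j)
  | 0 => inferInstanceAs (Fintype Unit)
  | j + 1 =>
    letI : Fintype (Tower α D j) := instFintype j
    inferInstanceAs (Fintype (Tower α D j × (Fin D → α × (Tower α D j × Tower α D j))))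

/-- The tree all of whose labels are `a`. -/
def const (a : α) : ∀ j, Tower α D j
  | 0 => ()
  | j + 1 => (const a j, fun _ => (a, (const a j, const a j)))

instance instNonempty [Nonempty α] (j : ℕ) : Nonempty (Tower α D j) :=
  ⟨const (Classical.arbitrary α) j⟩

/-- Apply a function to all labels. -/
def map (f : α → β) : ∀ {j}, Tower α D j → Tower β D j
  | 0, _ => ()
  | _ + 1, t => (map f t.1, fun i => (f (t.2 i).1, (map f (t.2 i).2.1, map f (t.2 i).2.2)))

theorem card_le [Fintype α] {n w : ℕ} (hn : 0 < n) (h : Fintype.card α ≤ n ^ w) (j : ℕ) :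
    Fintype.card (Tower α D j) ≤ n ^ (w * (2 * D + 1) ^ j) := by
  -- The spare factor `n ^ w` absorbs the labels of the new root in the induction.
  suffices h2 : Fintype.card (Tower α D j) * n ^ w ≤ n ^ (w * (2 * D + 1) ^ j) from
    le_trans (Nat.le_mul_of_pos_right _ (pow_pos hn _)) h2
  induction j with
  | zero =>
    have : Fintype.card (Tower α D 0) = 1 := Fintype.card_unit
    simp [this]
  | succ j ih =>
    set c := Fintype.card (Tower α D j) with hc
    have h1 : Fintype.card (Tower α D (j + 1)) = c * (Fintype.card α * (c * c)) ^ D := by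
      have : Fintype.card (Tower α D (j + 1)) =
        Fintype.card (Tower α D j × (Fin D → α × (Tower α D j × Tower α D j))) := rfl
      rw [this]
      simp [hc]
    rw [h1]
    have h3 : Fintype.card α * (c * c) ≤ (c * n ^ w) ^ 2 := by
      calc _ ≤ n ^ w * (c * c) := by gcongr
        _ ≤ n ^ w * (c * c) * n ^ w := Nat.le_mul_of_pos_right _ (pow_pos hn _)
        _ = _ := by ring
    calc c * (Fintype.card α * (c * c)) ^ D * n ^ w
        ≤ c * ((c * n ^ w) ^ 2) ^ D * n ^ w := by gcongr
      _ = (c * n ^ w) ^ (2 * D + 1) := by ring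
      _ ≤ (n ^ (w * (2 * D + 1) ^ j)) ^ (2 * D + 1) := by gcongr
      _ = _ := by rw [← pow_mul]; ring_nf

end Tower

/-! ### The tree determined by a seed and the passes. -/

namespace DiMultigraph

variable {n N D : ℕ}

/-- Whether an edge is incident to a given vertex; `none` has no incident edges. -/
def touches (v : Option (Fin n)) (e : Fin n × Fin n) : Bool :=
  decide (v = some e.1 ∨ v = some e.2)

/-- The edge in the pass `B` that has property `p` and the index `r`, reduced modulo the number
of such edges in the pass `A`. -/
def pick (A B : List (Fin n × Fin n)) (p : Fin n × Fin n → Bool) (r : ℕ) :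
    Option (Fin n × Fin n) :=
  (B.filter p)[r % A.countP p]?

/-- The tree of sampled edges: the slots at the root hold edges with property `p`, the two subtrees
below an edge hold samples of the edges at its endpoints. -/
def fill : ∀ j : ℕ, (Fin n × Fin n → Bool) → (ℕ → List (Fin n × Fin n)) → Tower (Fin N.factorial) D j →
    Tower (Option (Fin n × Fin n)) D j
  | 0, _, _, _ => ()
  | j + 1, p, L, ω =>
    (fill j p (fun t => L (t + 2)) ω.1, fun i =>
      (pick (L 0) (L 1) p (ω.2 i).1,
        (fill j (touches ((pick (L 0) (L 1) p (ω.2 i).1).map Prod.fst)) (fun t => L (t + 2))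
            (ω.2 i).2.1,
          fill j (touches ((pick (L 0) (L 1) p (ω.2 i).1).map Prod.snd)) (fun t => L (t + 2))
            (ω.2 i).2.2)))

end DiMultigraph

/-! ### The streaming procedure that samples the tree -/

namespace Sampler

variable {n N D : ℕ}

/-- A sampled edge, if there is one, and a counter. -/
abbrev Cell (n N : ℕ) : Type := Option (Fin n × Fin n) × Fin (N + 1)

/-- The counter of a cell serves three purposes in turn: `count` finds the number of eligible edges,
`reduce` replaces it by a residue of the seed, and `select` counts down from there to the chosen
edge. -/
def count (p : Fin n × Fin n → Bool) (c : Cell n N) (e : Fin n × Fin n) : Cell n N :=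
  (c.1, if p e then Fin.ofNat (N + 1) (c.2 + 1) else c.2)

def reduce (r : ℕ) (c : Cell n N) : Cell n N :=
  (c.1, Fin.ofNat (N + 1) (r % c.2))

def select (p : Fin n × Fin n → Bool) (c : Cell n N) (e : Fin n × Fin n) : Cell n N :=
  if p e ∧ c.1 = none then
    if (c.2 : ℕ) = 0 then (some e, c.2) else (none, Fin.ofNat (N + 1) (c.2 - 1))
  else c

theorem foldl_count (p : Fin n × Fin n → Bool) (A : List (Fin n × Fin n)) (c : Cell n N)
    (h : c.2 + A.length ≤ N) :
    (A.foldl (count p) c).1 = c.1 ∧ ((A.foldl (count p) c).2 : ℕ) = c.2 + A.countP p := by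
  induction A generalizing c with
  | nil => simp
  | cons e A ih =>
    simp only [List.length_cons] at h
    have h1 : ((count p c e).2 : ℕ) = c.2 + if p e then 1 else 0 := by
      unfold count
      split_ifs with hp
      · simp only [Fin.ofNat]
        exact Nat.mod_eq_of_lt (by omega)
      · simp
    have := ih (count p c e) (by rw [h1]; split_ifs <;> omega)
    rw [List.foldl_cons, this.1, this.2, h1, List.countP_cons]
    refine ⟨rfl, ?_⟩
    omega

theorem foldl_select_some (p : Fin n × Fin n → Bool) (A : List (Fin n × Fin n))
    (x : Fin n × Fin n) (c : Fin (N + 1)) : A.foldl (select p) (some x, c) = (some x, c) := by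
  induction A with
  | nil => rfl
  | cons e A ih => rw [List.foldl_cons]; simpa [select] using ih

theorem foldl_select (p : Fin n × Fin n → Bool) (A : List (Fin n × Fin n)) (c : Fin (N + 1)) :
    (A.foldl (select p) (none, c)).1 = (A.filter p)[(c : ℕ)]? := by
  induction A generalizing c with
  | nil => simp
  | cons e A ih =>
    rw [List.foldl_cons]
    by_cases hp : p e
    · by_cases hc : (c : ℕ) = 0
      · have : select p ((none, c) : Cell n N) e = (some e, c) := by simp [select, hp, hc]
        rw [this, foldl_select_some]
        simp [hp, hc]
      · have : select p ((none, c) : Cell n N) e = (none, Fin.ofNat (N + 1) (c - 1)) := by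
          simp [select, hp, hc]
        rw [this, ih]
        have h1 : ((Fin.ofNat (N + 1) (c - 1) : Fin (N + 1)) : ℕ) = c - 1 := by
          simp only [Fin.ofNat]
          exact Nat.mod_eq_of_lt (by omega)
        obtain ⟨d, hd⟩ := Nat.exists_eq_succ_of_ne_zero hc
        rw [h1, hd]
        simp [hp]
    · have : select p ((none, c) : Cell n N) e = (none, c) := by simp [select, hp]
      rw [this, ih]
      simp [hp]

/-- Update of the memory when an edge arrives in pass `t`. -/
def step : ∀ j : ℕ, (Fin n × Fin n → Bool) → ℕ → Tower (Cell n N) D j → Fin n × Fin n →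
    Tower (Cell n N) D j
  | 0, _, _, _, _ => ()
  | _ + 1, p, 0, m, e => (m.1, fun i => (count p (m.2 i).1 e, (m.2 i).2))
  | _ + 1, p, 1, m, e => (m.1, fun i => (select p (m.2 i).1 e, (m.2 i).2))
  | j + 1, p, t + 2, m, e =>
    (step j p t m.1 e, fun i => ((m.2 i).1,
      (step j (DiMultigraph.touches ((m.2 i).1.1.map Prod.fst)) t (m.2 i).2.1 e,
        step j (DiMultigraph.touches ((m.2 i).1.1.map Prod.snd)) t (m.2 i).2.2 e)))

/-- Update of the memory at the end of pass `t`. -/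
def finish : ∀ j : ℕ, Tower (Fin N.factorial) D j → ℕ → Tower (Cell n N) D j → Tower (Cell n N) D j
  | 0, _, _, _ => ()
  | _ + 1, ω, 0, m => (m.1, fun i => (reduce (ω.2 i).1 (m.2 i).1, (m.2 i).2))
  | _ + 1, _, 1, m => m
  | j + 1, ω, t + 2, m =>
    (finish j ω.1 t m.1, fun i => ((m.2 i).1,
      (finish j (ω.2 i).2.1 t (m.2 i).2.1, finish j (ω.2 i).2.2 t (m.2 i).2.2)))

/-- The memory after `s` passes, if the first of them is pass number `t`. -/
def run (j : ℕ) (p : Fin n × Fin n → Bool) (ω : Tower (Fin N.factorial) D j) :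
    ℕ → ℕ → (ℕ → List (Fin n × Fin n)) → Tower (Cell n N) D j → Tower (Cell n N) D j
  | _, 0, _, m => m
  | t, s + 1, L, m =>
    run j p ω (t + 1) s (fun u => L (u + 1)) (finish j ω t ((L 0).foldl (step j p t) m))

theorem foldl_step_add_two (j : ℕ) (p : Fin n × Fin n → Bool) (t : ℕ) (A : List (Fin n × Fin n))
    (m : Tower (Cell n N) D (j + 1)) :
    A.foldl (step (j + 1) p (t + 2)) m =
      (A.foldl (step j p t) m.1, fun i => ((m.2 i).1,
        (A.foldl (step j (DiMultigraph.touches ((m.2 i).1.1.map Prod.fst)) t) (m.2 i).2.1,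
          A.foldl (step j (DiMultigraph.touches ((m.2 i).1.1.map Prod.snd)) t) (m.2 i).2.2))) := by
  induction A generalizing m with
  | nil => rfl
  | cons e A ih => rw [List.foldl_cons, ih]; rfl

theorem foldl_step_zero (j : ℕ) (p : Fin n × Fin n → Bool) (A : List (Fin n × Fin n))
    (m : Tower (Cell n N) D (j + 1)) :
    A.foldl (step (j + 1) p 0) m =
      (m.1, fun i => (A.foldl (count p) (m.2 i).1, (m.2 i).2)) := by
  induction A generalizing m with
  | nil => rfl
  | cons e A ih => rw [List.foldl_cons, ih]; rfl

theorem foldl_step_one (j : ℕ) (p : Fin n × Fin n → Bool) (A : List (Fin n × Fin n))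
    (m : Tower (Cell n N) D (j + 1)) :
    A.foldl (step (j + 1) p 1) m =
      (m.1, fun i => (A.foldl (select p) (m.2 i).1, (m.2 i).2)) := by
  induction A generalizing m with
  | nil => rfl
  | cons e A ih => rw [List.foldl_cons, ih]; rfl

/-- After two passes the root labels are frozen, and the subtrees run independently with the clock
set back by two. -/
theorem run_add_two (j : ℕ) (p : Fin n × Fin n → Bool) (ω : Tower (Fin N.factorial) D (j + 1))
    (t s : ℕ) (L : ℕ → List (Fin n × Fin n)) (m : Tower (Cell n N) D (j + 1)) :
    run (j + 1) p ω (t + 2) s L m =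
      (run j p ω.1 t s L m.1, fun i => ((m.2 i).1,
        (run j (DiMultigraph.touches ((m.2 i).1.1.map Prod.fst)) (ω.2 i).2.1 t s L (m.2 i).2.1,
          run j (DiMultigraph.touches ((m.2 i).1.1.map Prod.snd)) (ω.2 i).2.2 t s L
            (m.2 i).2.2))) := by
  induction s generalizing t L m with
  | zero => rfl
  | succ s ih =>
    rw [run, foldl_step_add_two, show t + 2 + 1 = (t + 1) + 2 from rfl, ih]
    rfl

theorem map_run_const (j : ℕ) (p : Fin n × Fin n → Bool) (ω : Tower (Fin N.factorial) D j)
    (L : ℕ → List (Fin n × Fin n)) {E : List (Fin n × Fin n)} (hE : E.length ≤ N)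
    (hL : ∀ t, (L t).Perm E) :
    (run j p ω 0 (2 * j) L (Tower.const (none, 0) j)).map Prod.fst =
      DiMultigraph.fill j p L ω := by
  induction j generalizing p L with
  | zero => rfl
  | succ j ih =>
    have hc := foldl_count (N := N) p (L 0) (none, 0) (by simpa [(hL 0).length_eq] using hE)
    have hcell : ∀ i, ((L 1).foldl (select p)
        (reduce (ω.2 i).1 ((L 0).foldl (count p) ((none, 0) : Cell n N)))).1 =
        DiMultigraph.pick (L 0) (L 1) p (ω.2 i).1 := by
      intro i
      have h1 : reduce (ω.2 i).1 ((L 0).foldl (count p) ((none, 0) : Cell n N)) =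
          (none, Fin.ofNat (N + 1) ((ω.2 i).1 % (L 0).countP p)) := by
        unfold reduce
        rw [hc.1, hc.2]; simp
      rw [h1, foldl_select]
      unfold DiMultigraph.pick
      have h2 : (L 0).countP p ≤ N := List.countP_le_length.trans ((hL 0).length_eq.trans_le hE)
      -- With no eligible edge the modulus is zero and the counter is meaningless, but then there is
      -- nothing to select either.
      rcases Nat.eq_zero_or_pos ((L 0).countP p) with h0 | h0
      · have h3 : (L 1).filter p = [] := by
          rw [← List.length_eq_zero_iff, ← List.countP_eq_length_filter, (hL 1).countP_eq,
            ← (hL 0).countP_eq, h0]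
        simp [h3]
      · congr 1
        have := Nat.mod_lt (ω.2 i).1 h0
        simp only [Fin.ofNat]
        exact Nat.mod_eq_of_lt (by omega)
    have ih' := fun p ω => ih p ω (fun t => L (t + 2)) (fun t => hL (t + 2))
    have e0 := foldl_step_zero (D := D) j p (L 0) (Tower.const ((none, 0) : Cell n N) (j + 1))
    have e1 := foldl_step_one j p (L 1) (finish (j + 1) ω 0
      ((L 0).foldl (step (j + 1) p 0) (Tower.const ((none, 0) : Cell n N) (j + 1))))
    obtain ⟨M, hM⟩ : ∃ M, M = (L 1).foldl (step (j + 1) p 1) (finish (j + 1) ω 0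
      ((L 0).foldl (step (j + 1) p 0) (Tower.const ((none, 0) : Cell n N) (j + 1)))) := ⟨_, rfl⟩
    have e2 : run (j + 1) p ω 0 (2 * (j + 1)) L (Tower.const (none, 0) (j + 1)) =
      run (j + 1) p ω 2 (2 * j) (fun t => L (t + 2)) M := by rw [hM]; rfl
    rw [e1, e0] at hM
    rw [e2, run_add_two j p ω 0, hM]
    refine Prod.ext (ih' p ω.1) (funext fun i => ?_)
    refine Prod.ext (hcell i) (Prod.ext ?_ ?_)
    · refine (ih' _ _).trans ?_
      show DiMultigraph.fill j (DiMultigraph.touches (Option.map Prod.fst ((L 1).foldl (select p)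
        (reduce (ω.2 i).1 ((L 0).foldl (count p) ((none, 0) : Cell n N)))).1)) _ _ = _
      rw [hcell]; rfl
    · refine (ih' _ _).trans ?_
      show DiMultigraph.fill j (DiMultigraph.touches (Option.map Prod.snd ((L 1).foldl (select p)
        (reduce (ω.2 i).1 ((L 0).foldl (count p) ((none, 0) : Cell n N)))).1)) _ _ = _
      rw [hcell]; rfl

end Sampler

/-! ### Invariance under the order of the edges, and uniformity of the samples. -/

theorem List.Perm.exists_equiv {α : Type*} {l l' : List α} (h : l.Perm l') :
    ∃ σ : Fin l.length ≃ Fin l'.length, ∀ i, l'[σ i] = l[i] := by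
  classical
  have hc : ∀ x, Fintype.card {i : Fin l.length // l[i] = x} =
      Fintype.card {i : Fin l'.length // l'[i] = x} := by
    have key : ∀ (l : List α) (x : α), Fintype.card {i : Fin l.length // l[i] = x} = l.count x := by
      intro l x
      rw [Fintype.card_subtype]
      conv_rhs => rw [← List.ofFn_get l, ← Multiset.coe_count, ← Fin.univ_val_map,
        Multiset.count_map]
      rw [Finset.card_def, Finset.filter_val]
      simp [eq_comm]
    intro x
    rw [key, key, h.count_eq]
  let e := fun x => Fintype.equivOfCardEq (hc x)
  exact ⟨Equiv.ofFiberEquiv e, fun i => Equiv.ofFiberEquiv_map e i⟩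

namespace DiMultigraph

variable {n N D : ℕ}

/-- Identification of the indices below `N!` with pairs of a quotient and a residue modulo `d`. -/
def factorialEquiv {d N : ℕ} (hd : 0 < d) (hN : d ≤ N) :
    Fin (N.factorial / d) × Fin d ≃ Fin N.factorial :=
  finProdFinEquiv.trans (finCongr (Nat.div_mul_cancel (Nat.dvd_factorial hd hN)))

theorem factorialEquiv_mod {d N : ℕ} (hd : 0 < d) (hN : d ≤ N)
    (x : Fin (N.factorial / d) × Fin d) : (factorialEquiv hd hN x : ℕ) % d = x.2 := by
  simp [factorialEquiv, Nat.mod_eq_of_lt]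

/-- Both orders list the same eligible edges. Permute the residues accordingly and keep the
quotients. -/
theorem exists_equiv_pick {E A B A' B' : List (Fin n × Fin n)} (hE : E.length ≤ N)
    (hA : A.Perm E) (hB : B.Perm E) (hA' : A'.Perm E) (hB' : B'.Perm E)
    (p : Fin n × Fin n → Bool) :
    ∃ τ : Fin N.factorial ≃ Fin N.factorial, ∀ r, pick A B p (τ r) = pick A' B' p r := by
  have hd : A.countP p = A'.countP p := by rw [hA.countP_eq, hA'.countP_eq]
  have hBl : (B.filter p).length = A'.countP p := by
    rw [← List.countP_eq_length_filter, hB.countP_eq, hA'.countP_eq]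
  have hB'l : (B'.filter p).length = A'.countP p := by
    rw [← List.countP_eq_length_filter, hB'.countP_eq, hA'.countP_eq]
  have hN : A'.countP p ≤ N := List.countP_le_length.trans (hA'.length_eq.trans_le hE)
  unfold pick
  rw [hd]
  rcases Nat.eq_zero_or_pos (A'.countP p) with h0 | h0
  · refine ⟨Equiv.refl _, fun r => ?_⟩
    rw [List.getElem?_eq_none (by omega), List.getElem?_eq_none (by omega)]
  · obtain ⟨σ, hσ⟩ := ((hB'.trans hB.symm).filter p).exists_equiv
    let σ' : Fin (A'.countP p) ≃ Fin (A'.countP p) :=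
      (finCongr hB'l).symm.trans (σ.trans (finCongr hBl))
    let Φ := factorialEquiv h0 hN
    refine ⟨Φ.symm.trans ((Equiv.prodCongr (Equiv.refl _) σ').trans Φ), fun r => ?_⟩
    obtain ⟨x, rfl⟩ := Φ.surjective r
    simp only [Equiv.trans_apply, Equiv.symm_apply_apply, Φ]
    rw [factorialEquiv_mod, factorialEquiv_mod]
    have h1 : ((finCongr hB'l).symm x.2 : ℕ) = x.2 := rfl
    have h2 := hσ ((finCongr hB'l).symm x.2)
    have h3 : (((Equiv.prodCongr (Equiv.refl (Fin (N.factorial / A'.countP p))) σ') x).2 : ℕ) =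
      (σ ((finCongr hB'l).symm x.2) : ℕ) := rfl
    rw [h3, List.getElem?_eq_getElem (σ _).2, List.getElem?_eq_getElem (by omega)]
    exact congrArg some h2

/-- The distribution of the sampled tree does not depend on the orders of the passes. -/
theorem exists_equiv_fill {E : List (Fin n × Fin n)} (hE : E.length ≤ N) (j : ℕ)
    (p : Fin n × Fin n → Bool) {L L' : ℕ → List (Fin n × Fin n)} (hL : ∀ t, (L t).Perm E)
    (hL' : ∀ t, (L' t).Perm E) :
    ∃ σ : Tower (Fin N.factorial) D j ≃ Tower (Fin N.factorial) D j,
      ∀ ω, fill j p L (σ ω) = fill j p L' ω := by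
  induction j generalizing p L L' with
  | zero => exact ⟨Equiv.refl _, fun _ => rfl⟩
  | succ j ih =>
    have ih' := fun p => ih p (fun t => hL (t + 2)) (fun t => hL' (t + 2))
    choose S hS using ih'
    obtain ⟨τ, hτ⟩ := exists_equiv_pick hE (hL 0) (hL 1) (hL' 0) (hL' 1) p
    let f : Fin N.factorial → (Tower (Fin N.factorial) D j × Tower (Fin N.factorial) D j) ≃
        (Tower (Fin N.factorial) D j × Tower (Fin N.factorial) D j) := fun r =>
      Equiv.prodCongr (S (touches ((pick (L' 0) (L' 1) p r).map Prod.fst)))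
        (S (touches ((pick (L' 0) (L' 1) p r).map Prod.snd)))
    let g : Fin N.factorial × (Tower (Fin N.factorial) D j × Tower (Fin N.factorial) D j) ≃
        Fin N.factorial × (Tower (Fin N.factorial) D j × Tower (Fin N.factorial) D j) :=
      -- The permutation of the subtree seeds must depend on the edge picked above them, hence a
      -- shear and not a product.
      Equiv.prodShear τ f
    refine ⟨Equiv.prodCongr (S p) (Equiv.piCongrRight fun _ => g), fun ω => ?_⟩
    refine Prod.ext (hS p ω.1) (funext fun i => ?_)
    have h1 : ((g (ω.2 i)).1) = τ (ω.2 i).1 := rfl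
    have h2 : ((g (ω.2 i)).2) = f (ω.2 i).1 (ω.2 i).2 := rfl
    show (pick (L 0) (L 1) p (g (ω.2 i)).1,
        (fill j (touches ((pick (L 0) (L 1) p (g (ω.2 i)).1).map Prod.fst)) (fun t => L (t + 2))
            (g (ω.2 i)).2.1,
          fill j (touches ((pick (L 0) (L 1) p (g (ω.2 i)).1).map Prod.snd)) (fun t => L (t + 2))
            (g (ω.2 i)).2.2)) = _
    rw [h1, h2, hτ]
    exact Prod.ext rfl (Prod.ext (hS _ _) (hS _ _))

/-- A uniformly random index picks a uniformly random edge with the given property. -/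
theorem expect_pick {E : List (Fin n × Fin n)} (hE : E.length ≤ N) (p : Fin n × Fin n → Bool)
    (h0 : 0 < E.countP p) (g : Option (Fin n × Fin n) → ℝ) :
    𝔼 r : Fin N.factorial, g (pick E E p r) =
      ((E.filter p).map fun e => g (some e)).sum / E.countP p := by
  have hN : E.countP p ≤ N := List.countP_le_length.trans hE
  have : 0 < N.factorial / E.countP p :=
    Nat.div_pos (Nat.le_of_dvd (Nat.factorial_pos _) (Nat.dvd_factorial h0 hN)) h0
  have : Nonempty (Fin (N.factorial / E.countP p)) := ⟨⟨0, this⟩⟩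
  have hl : (E.filter p).length = E.countP p := List.countP_eq_length_filter.symm
  have h1 : ∀ x : Fin (N.factorial / E.countP p) × Fin (E.countP p),
      g (pick E E p (factorialEquiv h0 hN x)) =
        (fun y : Fin (E.countP p) => g (some ((E.filter p).get (Fin.cast hl.symm y)))) x.2 := by
    intro x
    unfold pick
    rw [factorialEquiv_mod, List.getElem?_eq_getElem (by omega)]
    rfl
  rw [← Fintype.expect_equiv (factorialEquiv h0 hN) _ _ fun x => (h1 x).symm,
    Fintype.expect_comp_snd (fun y : Fin (E.countP p) =>
      g (some ((E.filter p).get (Fin.cast hl.symm y)))),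
    Fintype.expect_eq_sum_div_card, Fintype.card_fin]
  congr 1
  rw [← Fintype.sum_equiv (finCongr hl) (fun i => g (some ((E.filter p).get i)))
    (fun y : Fin (E.countP p) => g (some ((E.filter p).get (Fin.cast hl.symm y)))) fun _ => rfl]
  conv_rhs => rw [← List.ofFn_get (E.filter p), List.map_ofFn, List.sum_ofFn]
  rfl

end DiMultigraph

/-! ### The gains and the choice made by double greedy. -/

namespace DiMultigraph

variable {n N D : ℕ}

/-- The gain per edge of moving `v` into the cut, when the later vertices have value `0`. The
values of the endpoints of the edge are `y` and `z`. -/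
noncomputable def addGain (χ : Fin n → ℕ) (v : Fin n) (e : Fin n × Fin n) (y z : ℝ) : ℝ :=
  if χ e.1 = χ e.2 then 0
  else if v = e.1 then (if χ e.2 < χ v then 1 - z else 1)
  else (if χ e.1 < χ v then -y else 0)

/-- The gain per edge of moving `v` out of the cut, when the later vertices have value `1`. -/
noncomputable def removeGain (χ : Fin n → ℕ) (v : Fin n) (e : Fin n × Fin n) (y z : ℝ) : ℝ :=
  if χ e.1 = χ e.2 then 0
  else if v = e.1 then (if χ e.2 < χ v then -(1 - z) else 0)
  else (if χ e.1 < χ v then y else 1)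

section gains

variable (χ : Fin n → ℕ) (v : Fin n) (e : Fin n × Fin n) {y z : ℝ}

theorem abs_addGain_le (hy : y ∈ Set.Icc (0 : ℝ) 1) (hz : z ∈ Set.Icc (0 : ℝ) 1) :
    |addGain χ v e y z| ≤ 1 := by
  obtain ⟨h1, h2⟩ := hy
  obtain ⟨h3, h4⟩ := hz
  unfold addGain
  rw [abs_le]
  split_ifs <;> constructor <;> linarith

theorem abs_removeGain_le (hy : y ∈ Set.Icc (0 : ℝ) 1) (hz : z ∈ Set.Icc (0 : ℝ) 1) :
    |removeGain χ v e y z| ≤ 1 := by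
  obtain ⟨h1, h2⟩ := hy
  obtain ⟨h3, h4⟩ := hz
  unfold removeGain
  rw [abs_le]
  split_ifs <;> constructor <;> linarith

/-- Submodularity, checked on a single edge. -/
theorem addGain_add_removeGain_nonneg : 0 ≤ addGain χ v e y z + removeGain χ v e y z := by
  unfold addGain removeGain
  split_ifs <;> linarith

/-- The gain is affine in the endpoint values, so independent unbiased estimates may be inserted for
them. -/
theorem expect_addGain {α β : Type*} [Fintype α] [Fintype β] [Nonempty α] [Nonempty β]
    (f : α → ℝ) (g : β → ℝ) :
    𝔼 x : α × β, addGain χ v e (f x.1) (g x.2) = addGain χ v e (𝔼 a, f a) (𝔼 b, g b) := by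
  unfold addGain
  split_ifs <;> simp [Finset.expect_sub_distrib, Finset.expect_neg_distrib,
    Fintype.expect_comp_fst f, Fintype.expect_comp_snd g]

theorem expect_removeGain {α β : Type*} [Fintype α] [Fintype β] [Nonempty α] [Nonempty β]
    (f : α → ℝ) (g : β → ℝ) :
    𝔼 x : α × β, removeGain χ v e (f x.1) (g x.2) = removeGain χ v e (𝔼 a, f a) (𝔼 b, g b) := by
  unfold removeGain
  split_ifs <;> simp [Finset.expect_sub_distrib,
    Fintype.expect_comp_fst f, Fintype.expect_comp_snd g]

end gains

/-- The probability with which the double greedy algorithm moves a vertex into the cut. -/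
noncomputable def ratio (a b : ℝ) : ℝ := max a 0 / (max a 0 + max b 0)

theorem ratio_mem_Icc (a b : ℝ) : ratio a b ∈ Set.Icc (0 : ℝ) 1 := by
  have ha : 0 ≤ max a 0 := le_max_right _ _
  have hb : 0 ≤ max b 0 := le_max_right _ _
  exact ⟨div_nonneg ha (add_nonneg ha hb), div_le_one_of_le₀ (by linarith) (add_nonneg ha hb)⟩

/-- For positive `a` and `b` this is `2ab ≤ a² + b²`. Otherwise the ratio is `0` or `1`, and `a + b
≥ 0` excludes two negative gains. -/
theorem ratio_ineq {a b o : ℝ} (h : 0 ≤ a + b) (ho : o = 0 ∨ o = 1) :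
    o * (1 - ratio a b) * a + (1 - o) * ratio a b * b ≤
      (ratio a b * a + (1 - ratio a b) * b) / 2 := by
  unfold ratio
  rcases le_total a 0 with ha | ha
  · have hb : 0 ≤ b := by linarith
    rw [max_eq_right ha]
    rcases ho with rfl | rfl <;> simp <;> linarith
  rcases le_total b 0 with hb | hb
  · rw [max_eq_right hb, max_eq_left ha]
    rcases ha.eq_or_lt with rfl | ha'
    · have : b = 0 := by linarith
      simp [this]
    · rw [add_zero, div_self ha'.ne']
      rcases ho with rfl | rfl <;> simp <;> linarith
  · rw [max_eq_left ha, max_eq_left hb]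
    rcases h.eq_or_lt with h0 | h0
    · have h1 : a = 0 := by linarith
      have h2 : b = 0 := by linarith
      simp [h1, h2]
    · have h1 : 1 - a / (a + b) = b / (a + b) := by field_simp; ring
      rw [h1]
      have h2 : 0 ≤ (a - b) ^ 2 / (2 * (a + b)) := by positivity
      have h3 : (a / (a + b) * a + b / (a + b) * b) / 2 - a * b / (a + b) =
        (a - b) ^ 2 / (2 * (a + b)) := by field_simp; ring
      have h4 : b / (a + b) * a = a * b / (a + b) := by ring
      have h5 : a / (a + b) * b = a * b / (a + b) := by ring
      rcases ho with rfl | rfl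
      · simp only [zero_mul, sub_zero, one_mul, zero_add, h5]; linarith
      · simp only [one_mul, sub_self, zero_mul, add_zero, h4]; linarith

/-- Here `a`, `b` are sampled gains and `a'`, `b'` the true ones. The left side is affine in the
ratio with coefficients free of the sample, so averaging over samples replaces the ratio by its
mean. -/
theorem ratio_ineq_of_approx {a b a' b' o : ℝ} (h : 0 ≤ a + b) (ho : o = 0 ∨ o = 1) :
    (o * a' - b' / 2) + (-o * a' + (1 - o) * b' - a' / 2 + b' / 2) * ratio a b ≤
      |a - a'| + |b - b'| := by
  have h1 := ratio_ineq h ho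
  obtain ⟨h2, h3⟩ := ratio_mem_Icc a b
  set p := ratio a b
  have ha := abs_le.1 (le_refl |a - a'|)
  have hb := abs_le.1 (le_refl |b - b'|)
  set s := |a - a'|
  set t := |b - b'|
  rcases ho with rfl | rfl <;> nlinarith [mul_nonneg h2 (sub_nonneg.2 ha.1),
    mul_nonneg h2 (sub_nonneg.2 ha.2), mul_nonneg h2 (sub_nonneg.2 hb.1),
    mul_nonneg h2 (sub_nonneg.2 hb.2), mul_nonneg (sub_nonneg.2 h3) (sub_nonneg.2 ha.1),
    mul_nonneg (sub_nonneg.2 h3) (sub_nonneg.2 ha.2),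
    mul_nonneg (sub_nonneg.2 h3) (sub_nonneg.2 hb.1),
    mul_nonneg (sub_nonneg.2 h3) (sub_nonneg.2 hb.2), abs_nonneg (a - a'), abs_nonneg (b - b')]

/-! ### Recursive estimates and the fractional cut. -/

/-- A tree of sampled edges. -/
abbrev EdgeTree (n D j : ℕ) : Type := Tower (Option (Fin n × Fin n)) D j

/-- A seed for sampling a tree. -/
abbrev TreeSeed (N D j : ℕ) : Type := Tower (Fin N.factorial) D j

instance (N : ℕ) : Nonempty (Fin N.factorial) := ⟨⟨0, Nat.factorial_pos N⟩⟩

/-- The estimate for the fractional cut at a vertex `v` of colour less than `j`, computed from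
a sampled tree for the edges at `v`. -/
noncomputable def est (χ : Fin n → ℕ) : ∀ j, Fin n → EdgeTree n D j → ℝ
  | 0, _, _ => 0
  | j + 1, v, t =>
    if χ v = j then
      ratio
        (𝔼 i, (t.2 i).1.elim 0 fun e =>
          addGain χ v e (est χ j e.1 (t.2 i).2.1) (est χ j e.2 (t.2 i).2.2))
        (𝔼 i, (t.2 i).1.elim 0 fun e =>
          removeGain χ v e (est χ j e.1 (t.2 i).2.1) (est χ j e.2 (t.2 i).2.2))
    else est χ j v t.1

theorem est_mem_Icc (χ : Fin n → ℕ) (j : ℕ) (v : Fin n) (t : EdgeTree n D j) :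
    est χ j v t ∈ Set.Icc (0 : ℝ) 1 := by
  induction j generalizing v with
  | zero => simp [est]
  | succ j ih =>
    unfold est
    split_ifs
    · exact ratio_mem_Icc _ _
    · exact ih _ _

/-- The sampled tree for a constant sequence of passes. -/
def sample (E : List (Fin n × Fin n)) (j : ℕ) (p : Fin n × Fin n → Bool) (ω : TreeSeed N D j) :
    EdgeTree n D j := fill j p (fun _ => E) ω

/-- The fractional cut. -/
noncomputable def frac (N D : ℕ) (E : List (Fin n × Fin n)) (χ : Fin n → ℕ) (j : ℕ) (v : Fin n) :
    ℝ :=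
  𝔼 ω : TreeSeed N D j, est χ j v (sample E j (touches (some v)) ω)

theorem frac_mem_Icc (E : List (Fin n × Fin n)) (χ : Fin n → ℕ) (j : ℕ) (v : Fin n) :
    frac N D E χ j v ∈ Set.Icc (0 : ℝ) 1 :=
  ⟨Finset.expect_nonneg fun _ _ => (est_mem_Icc χ j v _).1,
    Finset.expect_le Finset.univ_nonempty fun _ _ => (est_mem_Icc χ j v _).2⟩

theorem frac_succ_of_ne (E : List (Fin n × Fin n)) (χ : Fin n → ℕ) (j : ℕ) (v : Fin n)
    (h : χ v ≠ j) : frac N D E χ (j + 1) v = frac N D E χ j v := by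
  have h1 : ∀ ω : TreeSeed N D (j + 1), est χ (j + 1) v (sample E (j + 1) (touches (some v)) ω) =
      est χ j v (sample E j (touches (some v)) ω.1) := fun ω => by
    rw [est, if_neg h]; rfl
  unfold frac
  simp only [h1]
  exact Fintype.expect_comp_fst (α := TreeSeed N D j)
    (β := Fin D → Fin N.factorial × (TreeSeed N D j × TreeSeed N D j))
    fun ω => est χ j v (sample E j (touches (some v)) ω)

/-- Levels above the colour of `v` only pass on the extra subtree, so the value is settled once its
colour has been reached. -/
theorem frac_eq_of_lt (E : List (Fin n × Fin n)) (χ : Fin n → ℕ) {j k : ℕ} (v : Fin n)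
    (h : χ v < j) (hk : j ≤ k) : frac N D E χ k v = frac N D E χ j v := by
  induction k, hk using Nat.le_induction with
  | base => rfl
  | succ k hk ih => rw [frac_succ_of_ne _ _ _ _ (by omega), ih]

/-- The slot of a sampled tree that belongs to one seed. -/
def slot (E : List (Fin n × Fin n)) (j : ℕ) (p : Fin n × Fin n → Bool)
    (x : Fin N.factorial × (TreeSeed N D j × TreeSeed N D j)) :
    Option (Fin n × Fin n) × (EdgeTree n D j × EdgeTree n D j) :=
  (pick E E p x.1, (sample E j (touches ((pick E E p x.1).map Prod.fst)) x.2.1,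
    sample E j (touches ((pick E E p x.1).map Prod.snd)) x.2.2))

/-- Given the picked edge, the two subtrees are independent samples at its endpoints; then average
over the edge. -/
theorem expect_slot {E : List (Fin n × Fin n)} (hE : E.length ≤ N) (j : ℕ)
    (p : Fin n × Fin n → Bool) (h0 : 0 < E.countP p)
    (f : Fin n × Fin n → EdgeTree n D j → EdgeTree n D j → ℝ) (g : Fin n × Fin n → ℝ)
    (hfg : ∀ e, 𝔼 x : TreeSeed N D j × TreeSeed N D j,
      f e (sample E j (touches (some e.1)) x.1) (sample E j (touches (some e.2)) x.2) = g e) :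
    𝔼 x : Fin N.factorial × (TreeSeed N D j × TreeSeed N D j),
      (slot E j p x).1.elim 0 (fun e => f e (slot E j p x).2.1 (slot E j p x).2.2) =
        ((E.filter p).map g).sum / E.countP p := by
  rw [Fintype.expect_prod]
  have h1 : ∀ r : Fin N.factorial, 𝔼 x : TreeSeed N D j × TreeSeed N D j,
      (slot E j p (r, x)).1.elim 0
        (fun e => f e (slot E j p (r, x)).2.1 (slot E j p (r, x)).2.2) =
      (pick E E p r).elim 0 g := by
    intro r
    unfold slot
    dsimp only
    cases pick E E p r with
    | none => simp
    | some e => simpa using hfg e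
  simp only [h1]
  exact expect_pick hE p h0 fun o => o.elim 0 g

end DiMultigraph

/-! ### The fractional cut has nearly half the optimal value. -/

namespace DiMultigraph

variable {n N D : ℕ}

theorem frac_succ_of_eq (E : List (Fin n × Fin n)) (χ : Fin n → ℕ) (j : ℕ) (v : Fin n)
    (h : χ v = j) : frac N D E χ (j + 1) v =
      𝔼 ω : Fin D → Fin N.factorial × (TreeSeed N D j × TreeSeed N D j), ratio
        (𝔼 i, (slot E j (touches (some v)) (ω i)).1.elim 0 fun e => addGain χ v e
          (est χ j e.1 (slot E j (touches (some v)) (ω i)).2.1)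
          (est χ j e.2 (slot E j (touches (some v)) (ω i)).2.2))
        (𝔼 i, (slot E j (touches (some v)) (ω i)).1.elim 0 fun e => removeGain χ v e
          (est χ j e.1 (slot E j (touches (some v)) (ω i)).2.1)
          (est χ j e.2 (slot E j (touches (some v)) (ω i)).2.2)) := by
  rw [← Fintype.expect_comp_snd (α := TreeSeed N D j)]
  unfold frac
  refine Finset.expect_congr rfl fun ω _ => ?_
  rw [est, if_pos h]
  rfl

/-- The inequality behind the double greedy algorithm, up to the sampling error. -/
theorem vertex_ineq {E : List (Fin n × Fin n)} (hE : E.length ≤ N) {H : ℕ} (hH : 0 < H)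
    (χ : Fin n → ℕ) {j : ℕ} {v : Fin n} (hv : χ v = j) {o Q : ℝ} (ho : o = 0 ∨ o = 1)
    (hQ : Q = frac N (H ^ 2) E χ (j + 1) v) {a b : ℝ}
    (ha : a = ((E.filter (touches (some v))).map fun e =>
      addGain χ v e (frac N (H ^ 2) E χ j e.1) (frac N (H ^ 2) E χ j e.2)).sum)
    (hb : b = ((E.filter (touches (some v))).map fun e =>
      removeGain χ v e (frac N (H ^ 2) E χ j e.1) (frac N (H ^ 2) E χ j e.2)).sum) :
    o * (1 - Q) * a + (1 - o) * Q * b ≤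
      (Q * a + (1 - Q) * b) / 2 + E.countP (touches (some v)) * (2 / H) := by
  rcases Nat.eq_zero_or_pos (E.countP (touches (some v))) with h0 | h0
  · have h1 : E.filter (touches (some v)) = [] := by
      rw [← List.length_eq_zero_iff, ← List.countP_eq_length_filter, h0]
    rw [h1] at ha hb
    simp [ha, hb, h0]
  · have hH' : (0 : ℝ) < H := by exact_mod_cast hH
    have hd : (0 : ℝ) < E.countP (touches (some v)) := by exact_mod_cast h0
    set d : ℝ := ((E.countP (touches (some v)) : ℕ) : ℝ) with hd_def
    set A : Fin N.factorial × (TreeSeed N (H ^ 2) j × TreeSeed N (H ^ 2) j) → ℝ := fun x =>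
      (slot E j (touches (some v)) x).1.elim 0 fun e => addGain χ v e
          (est χ j e.1 (slot E j (touches (some v)) x).2.1)
          (est χ j e.2 (slot E j (touches (some v)) x).2.2) with hA
    set B : Fin N.factorial × (TreeSeed N (H ^ 2) j × TreeSeed N (H ^ 2) j) → ℝ := fun x =>
      (slot E j (touches (some v)) x).1.elim 0 fun e => removeGain χ v e
          (est χ j e.1 (slot E j (touches (some v)) x).2.1)
          (est χ j e.2 (slot E j (touches (some v)) x).2.2) with hB
    have hEA : 𝔼 x, A x = a / d := by
      rw [ha]
      exact expect_slot hE j (touches (some v)) h0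
        (fun e s t => addGain χ v e (est χ j e.1 s) (est χ j e.2 t)) _
        fun e => expect_addGain χ v e
          (fun ω : TreeSeed N (H ^ 2) j => est χ j e.1 (sample E j (touches (some e.1)) ω))
          (fun ω : TreeSeed N (H ^ 2) j => est χ j e.2 (sample E j (touches (some e.2)) ω))
    have hEB : 𝔼 x, B x = b / d := by
      rw [hb]
      exact expect_slot hE j (touches (some v)) h0
        (fun e s t => removeGain χ v e (est χ j e.1 s) (est χ j e.2 t)) _
        fun e => expect_removeGain χ v e
          (fun ω : TreeSeed N (H ^ 2) j => est χ j e.1 (sample E j (touches (some e.1)) ω))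
          (fun ω : TreeSeed N (H ^ 2) j => est χ j e.2 (sample E j (touches (some e.2)) ω))
    have hA1 : ∀ x, |A x| ≤ 1 := fun x => by
      simp only [hA]
      cases (slot E j (touches (some v)) x).1 with
      | none => simp
      | some e => exact abs_addGain_le _ _ _ (est_mem_Icc _ _ _ _) (est_mem_Icc _ _ _ _)
    have hB1 : ∀ x, |B x| ≤ 1 := fun x => by
      simp only [hB]
      cases (slot E j (touches (some v)) x).1 with
      | none => simp
      | some e => exact abs_removeGain_le _ _ _ (est_mem_Icc _ _ _ _) (est_mem_Icc _ _ _ _)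
    have hAB : ∀ x, 0 ≤ A x + B x := fun x => by
      simp only [hA, hB]
      cases (slot E j (touches (some v)) x).1 with
      | none => simp
      | some e => exact addGain_add_removeGain_nonneg _ _ _
    have hAE := Fintype.expect_abs_sampleMean_sub_le A hA1 hH hEA
    have hBE := Fintype.expect_abs_sampleMean_sub_le B hB1 hH hEB
    have hpt : ∀ ω : Fin (H ^ 2) → Fin N.factorial × (TreeSeed N (H ^ 2) j × TreeSeed N (H ^ 2) j),
        (o * (a / d) - (b / d) / 2) + (-o * (a / d) + (1 - o) * (b / d) - (a / d) / 2 + (b / d) / 2)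
          * ratio (𝔼 i, A (ω i)) (𝔼 i, B (ω i)) ≤
        |𝔼 i, A (ω i) - a / d| + |𝔼 i, B (ω i) - b / d| := fun ω =>
      -- The sampled gains inherit the nonnegative sum edge by edge, so the double greedy inequality
      -- applies to every sample.
      ratio_ineq_of_approx (by
        rw [← Finset.expect_add_distrib]
        exact Finset.expect_nonneg fun i _ => hAB _) ho
    have hsum := Finset.expect_le_expect (s := Finset.univ) fun ω _ => hpt ω
    rw [Finset.expect_add_distrib, Finset.expect_add_distrib, Fintype.expect_const,
      ← Finset.mul_expect, ← frac_succ_of_eq E χ j v hv, ← hQ] at hsum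
    have h3 : (o * (a / d) - (b / d) / 2) +
        (-o * (a / d) + (1 - o) * (b / d) - (a / d) / 2 + (b / d) / 2) * Q ≤ 2 / H := by
      have : (2 : ℝ) / H = 1 / H + 1 / H := by ring
      linarith
    have h4 := mul_le_mul_of_nonneg_left h3 hd.le
    have h5 : d * ((o * (a / d) - (b / d) / 2) +
        (-o * (a / d) + (1 - o) * (b / d) - (a / d) / 2 + (b / d) / 2) * Q) =
        (o * a - b / 2) + (-o * a + (1 - o) * b - a / 2 + b / 2) * Q := by
      field_simp
    linarith

/-- Double counting of incidences. -/
theorem sum_map_filter_touches (E : List (Fin n × Fin n)) (hE : ∀ e ∈ E, e.1 ≠ e.2)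
    (h : Fin n → Fin n × Fin n → ℝ) :
    ∑ v, ((E.filter (touches (some v))).map (h v)).sum =
      (E.map fun e => h e.1 e + h e.2 e).sum := by
  induction E with
  | nil => simp
  | cons e E ih =>
    have he : e.1 ≠ e.2 := hE e (by simp)
    have h1 : ∀ v, (((e :: E).filter (touches (some v))).map (h v)).sum =
        ((if v = e.1 then h v e else 0) + if v = e.2 then h v e else 0) +
          ((E.filter (touches (some v))).map (h v)).sum := by
      intro v
      rw [List.filter_cons]
      by_cases h1 : v = e.1
      · have h2 : v ≠ e.2 := fun h2 => he (h1 ▸ h2)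
        simp [touches, h1, he]
      · by_cases h2 : v = e.2
        · simp [touches, h2, he.symm]
        · simp [touches, h1, h2]
    simp only [h1]
    rw [Finset.sum_add_distrib, Finset.sum_add_distrib, ih fun x hx => hE x (by simp [hx])]
    simp

theorem sum_countP_touches (E : List (Fin n × Fin n)) (hE : ∀ e ∈ E, e.1 ≠ e.2) :
    ∑ v, (E.countP (touches (some v)) : ℝ) = 2 * E.length := by
  have := sum_map_filter_touches E hE fun _ _ => 1
  simp only [List.map_const', List.sum_replicate, nsmul_eq_mul, mul_one,
    ← List.countP_eq_length_filter] at this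
  rw [this]
  ring

/-- The value of the fractional cut, up to normalization. -/
def weight (E : List (Fin n × Fin n)) (q : Fin n → ℝ) : ℝ :=
  (E.map fun e => q e.1 * (1 - q e.2)).sum

/-- The number of edges of a cut whose endpoints have different colours. -/
def bicolored (E : List (Fin n × Fin n)) (χ : Fin n → ℕ) (o : Fin n → ℝ) : ℝ :=
  (E.map fun e => if χ e.1 = χ e.2 then 0 else o e.1 * (1 - o e.2)).sum

/-- On a bicoloured edge, the two gain terms `q * addGain + (1 - q) * removeGain` add up to twice
the fractional value, by telescoping from both trivial cuts. Submodularity bounds the loss of `o` by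
the remaining terms. A monochromatic edge has no gains. -/
theorem edge_ineq (χ : Fin n → ℕ) {e : Fin n × Fin n} (he : e.1 ≠ e.2) {q o : Fin n → ℝ}
    (hq : ∀ v, q v ∈ Set.Icc (0 : ℝ) 1) (ho : ∀ v, o v = 0 ∨ o v = 1) :
    (if χ e.1 = χ e.2 then 0 else o e.1 * (1 - o e.2)) ≤ 2 * (q e.1 * (1 - q e.2)) +
      ((o e.1 * (1 - q e.1) * addGain χ e.1 e (q e.1) (q e.2) +
          (1 - o e.1) * q e.1 * removeGain χ e.1 e (q e.1) (q e.2) -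
          (q e.1 * addGain χ e.1 e (q e.1) (q e.2) +
            (1 - q e.1) * removeGain χ e.1 e (q e.1) (q e.2)) / 2) +
        (o e.2 * (1 - q e.2) * addGain χ e.2 e (q e.1) (q e.2) +
          (1 - o e.2) * q e.2 * removeGain χ e.2 e (q e.1) (q e.2) -
          (q e.2 * addGain χ e.2 e (q e.1) (q e.2) +
            (1 - q e.2) * removeGain χ e.2 e (q e.1) (q e.2)) / 2)) := by
  obtain ⟨h1, h2⟩ := hq e.1
  obtain ⟨h3, h4⟩ := hq e.2
  have h5 := mul_nonneg h1 (sub_nonneg.2 h4)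
  unfold addGain removeGain
  rcases lt_trichotomy (χ e.1) (χ e.2) with h | h | h
  · simp only [h.ne, he.symm, if_true, if_false, h, not_lt_of_gt h]
    rcases ho e.1 with h6 | h6 <;> rcases ho e.2 with h7 | h7 <;> rw [h6, h7] <;> nlinarith
  · simp only [h, if_true]
    nlinarith
  · simp only [h.ne', he.symm, if_true, if_false, h, not_lt_of_gt h]
    rcases ho e.1 with h6 | h6 <;> rcases ho e.2 with h7 | h7 <;> rw [h6, h7] <;> nlinarith

theorem addGain_congr (χ : Fin n → ℕ) (v : Fin n) {e : Fin n × Fin n} {y z y' z' : ℝ}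
    (hy : χ e.1 < χ v → y = y') (hz : χ e.2 < χ v → z = z') :
    addGain χ v e y z = addGain χ v e y' z' := by
  unfold addGain
  split_ifs <;> simp_all

theorem removeGain_congr (χ : Fin n → ℕ) (v : Fin n) {e : Fin n × Fin n} {y z y' z' : ℝ}
    (hy : χ e.1 < χ v → y = y') (hz : χ e.2 < χ v → z = z') :
    removeGain χ v e y z = removeGain χ v e y' z' := by
  unfold removeGain
  split_ifs <;> simp_all

theorem sum_map_mul_add {α : Type*} (l : List α) (c d : ℝ) (f g : α → ℝ) :
    (l.map fun e => c * f e + d * g e).sum = c * (l.map f).sum + d * (l.map g).sum := by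
  rw [List.sum_map_add, List.sum_map_mul_left, List.sum_map_mul_left]

/-- The fractional cut has half the value of every cut of the bicoloured edges, up to the sampling
error. -/
theorem bicolored_le {E : List (Fin n × Fin n)} (hE : E.length ≤ N) (hE' : ∀ e ∈ E, e.1 ≠ e.2)
    {H k : ℕ} (hH : 0 < H) (χ : Fin n → ℕ) (hχ : ∀ v, χ v < k) {o : Fin n → ℝ}
    (ho : ∀ v, o v = 0 ∨ o v = 1) :
    bicolored E χ o ≤ 2 * weight E (frac N (H ^ 2) E χ k) + 4 * E.length / H := by
  set q := frac N (H ^ 2) E χ k with hq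
  have hvert : ∀ v, ((E.filter (touches (some v))).map fun e =>
      (o v * (1 - q v) - q v / 2) * addGain χ v e (q e.1) (q e.2) +
        ((1 - o v) * q v - (1 - q v) / 2) * removeGain χ v e (q e.1) (q e.2)).sum ≤
        E.countP (touches (some v)) * (2 / H) := by
    intro v
    -- Gains at `v` only see values of smaller colours, and these are already final at level `χ v`.
    have hQ : q v = frac N (H ^ 2) E χ (χ v + 1) v :=
      frac_eq_of_lt E χ v (Nat.lt_succ_self _) (hχ v)
    have hw : ∀ w, χ w < χ v → q w = frac N (H ^ 2) E χ (χ v) w := fun w hw =>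
      frac_eq_of_lt E χ w hw (hχ v).le
    have := vertex_ineq hE hH χ rfl (ho v) hQ rfl rfl
    rw [sum_map_mul_add]
    simp only [← addGain_congr χ v (hw _) (hw _), ← removeGain_congr χ v (hw _) (hw _)] at this
    linarith
  have hsum := Finset.sum_le_sum fun v (_ : v ∈ Finset.univ) => hvert v
  rw [sum_map_filter_touches E hE' fun v e =>
      (o v * (1 - q v) - q v / 2) * addGain χ v e (q e.1) (q e.2) +
        ((1 - o v) * q v - (1 - q v) / 2) * removeGain χ v e (q e.1) (q e.2),
    ← Finset.sum_mul, sum_countP_touches E hE'] at hsum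
  have hq01 : ∀ v, q v ∈ Set.Icc (0 : ℝ) 1 := fun v => frac_mem_Icc E χ k v
  have hedge : bicolored E χ o ≤ (E.map fun e => 2 * (q e.1 * (1 - q e.2)) + 1 *
      (((o e.1 * (1 - q e.1) - q e.1 / 2) * addGain χ e.1 e (q e.1) (q e.2) +
        ((1 - o e.1) * q e.1 - (1 - q e.1) / 2) * removeGain χ e.1 e (q e.1) (q e.2)) +
      ((o e.2 * (1 - q e.2) - q e.2 / 2) * addGain χ e.2 e (q e.1) (q e.2) +
        ((1 - o e.2) * q e.2 - (1 - q e.2) / 2) * removeGain χ e.2 e (q e.1) (q e.2)))).sum := by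
    refine List.sum_le_sum fun e he => ?_
    have := edge_ineq χ (hE' e he) hq01 ho
    linarith
  rw [sum_map_mul_add] at hedge
  have h2 : (2 : ℝ) * E.length * (2 / H) = 4 * E.length / H := by ring
  unfold weight
  linarith

end DiMultigraph

/-! ### Rounding and the maximum cut value. -/

namespace DiMultigraph

variable {n N D : ℕ}

theorem weight_eq_update {E : List (Fin n × Fin n)} (hE : ∀ e ∈ E, e.1 ≠ e.2) (q : Fin n → ℝ)
    (a : Fin n) : weight E q =
      q a * weight E (Function.update q a 1) + (1 - q a) * weight E (Function.update q a 0) := by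
  unfold weight
  rw [← sum_map_mul_add]
  congr 1
  refine List.map_congr_left fun e he => ?_
  have := hE e he
  simp only [Function.update_apply]
  by_cases h1 : e.1 = a
  · have h2 : e.2 ≠ a := fun h2 => this (h1.trans h2.symm)
    simp [h1, h2]
  · by_cases h2 : e.2 = a
    · simp [h1, h2]; ring
    · simp [h1, h2]; ring

/-- Without loops the weight is affine in each coordinate, so coordinates can be rounded one by one.
-/
theorem weight_le_of_forall {E : List (Fin n × Fin n)} (hE : ∀ e ∈ E, e.1 ≠ e.2) {M : ℝ}
    (hM : ∀ x : Fin n → Bool, weight E (fun v => if x v then 1 else 0) ≤ M) {q : Fin n → ℝ}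
    (hq : ∀ v, q v ∈ Set.Icc (0 : ℝ) 1) : weight E q ≤ M := by
  suffices h : ∀ s : Finset (Fin n), ∀ q : Fin n → ℝ, (∀ v, q v ∈ Set.Icc (0 : ℝ) 1) →
      (∀ v ∉ s, q v = 0 ∨ q v = 1) → weight E q ≤ M from
    h Finset.univ q hq fun v hv => absurd (Finset.mem_univ v) hv
  intro s
  induction s using Finset.induction_on with
  | empty =>
    intro q _ h01
    have : q = fun v => if (fun v => decide (q v = 1)) v then 1 else 0 := by
      funext v
      rcases h01 v (by simp) with h | h <;> simp [h]
    rw [this]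
    exact hM _
  | insert a s ha ih =>
    intro q hq h01
    have key : ∀ c : ℝ, c = 0 ∨ c = 1 → weight E (Function.update q a c) ≤ M := by
      intro c hc
      refine ih _ (fun v => ?_) fun v hv => ?_
      · by_cases hva : v = a
        · subst hva; rcases hc with rfl | rfl <;> simp
        · rw [Function.update_of_ne hva]; exact hq v
      · by_cases hva : v = a
        · subst hva; simpa using hc
        · rw [Function.update_of_ne hva]; exact h01 v (by simp [hva, hv])
    rw [weight_eq_update hE q a]
    obtain ⟨h1, h2⟩ := hq a
    have h3 := mul_le_mul_of_nonneg_left (key 1 (Or.inr rfl)) h1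
    have h4 := mul_le_mul_of_nonneg_left (key 0 (Or.inl rfl)) (sub_nonneg.2 h2)
    linarith

theorem cutValue_eq (G : DiMultigraph n) {E : List (Fin n × Fin n)}
    (hE : (E : Multiset (Fin n × Fin n)) = G.edges) (x : Fin n → Bool) :
    G.cutValue x = weight E (fun v => if x v then 1 else 0) / E.length := by
  unfold cutValue weight
  rw [← hE, Multiset.coe_card, Multiset.coe_countP]
  congr 1
  induction E generalizing G with
  | nil => simp
  | cons e E ih =>
    have := ih ⟨E, fun e he => G.loopless e (by rw [← hE]; simp at he ⊢; exact Or.inr he)⟩ rfl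
    rw [List.countP_cons, List.map_cons, List.sum_cons, ← this]
    by_cases h1 : x e.1 <;> by_cases h2 : x e.2 <;> simp [h1, h2]
    ring

theorem cutValue_le_maxval (G : DiMultigraph n) (x : Fin n → Bool) : G.cutValue x ≤ G.maxval :=
  Finset.le_sup' _ (Finset.mem_univ x)

theorem exists_cutValue_eq_maxval (G : DiMultigraph n) : ∃ x, G.cutValue x = G.maxval := by
  obtain ⟨x, _, hx⟩ := Finset.exists_mem_eq_sup' (Finset.univ_nonempty (α := Fin n → Bool))
    G.cutValue
  exact ⟨x, hx.symm⟩

theorem maxval_nonneg (G : DiMultigraph n) : 0 ≤ G.maxval := by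
  obtain ⟨x, hx⟩ := G.exists_cutValue_eq_maxval
  rw [← hx]
  unfold cutValue
  positivity

theorem maxval_eq_zero (G : DiMultigraph n) (h : Multiset.card G.edges = 0) : G.maxval = 0 := by
  obtain ⟨x, hx⟩ := G.exists_cutValue_eq_maxval
  rw [← hx]
  simp [cutValue, h]

theorem weight_div_le_maxval (G : DiMultigraph n) {E : List (Fin n × Fin n)}
    (hE : (E : Multiset (Fin n × Fin n)) = G.edges) (h0 : 0 < E.length) {q : Fin n → ℝ}
    (hq : ∀ v, q v ∈ Set.Icc (0 : ℝ) 1) : weight E q / E.length ≤ G.maxval := by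
  have h0' : (0 : ℝ) < E.length := by exact_mod_cast h0
  rw [div_le_iff₀ h0']
  refine weight_le_of_forall (fun e he => G.loopless e (by rw [← hE]; simpa using he))
    (fun x => ?_) hq
  rw [← div_le_iff₀ h0', ← cutValue_eq G hE]
  exact G.cutValue_le_maxval x

/-- Evaluate the constant fractional cut `1 / 2`. This turns additive errors into multiplicative
ones. -/
theorem quarter_le_maxval (G : DiMultigraph n) (h0 : 0 < Multiset.card G.edges) :
    1 / 4 ≤ G.maxval := by
  have hE : (G.edges.toList : Multiset (Fin n × Fin n)) = G.edges := Multiset.coe_toList _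
  have h1 : 0 < G.edges.toList.length := by simpa using h0
  have h1' : (0 : ℝ) < G.edges.toList.length := by exact_mod_cast h1
  refine le_trans ?_ (G.weight_div_le_maxval hE h1 (q := fun _ => 1 / 2) fun v => by norm_num)
  rw [le_div_iff₀ h1']
  simp only [weight, List.map_const', List.sum_replicate, nsmul_eq_mul]
  linarith

/-! ### Random colourings -/

theorem expect_color_eq {k : ℕ} (hk : 0 < k) {u w : Fin n} (h : u ≠ w) :
    𝔼 χ : Fin n → Fin k, (if χ u = χ w then (1 : ℝ) else 0) = 1 / k := by
  have : NeZero k := ⟨hk.ne'⟩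
  -- Shifting the colour of `u` alone preserves the uniform measure; averaged over all shifts,
  -- exactly one shift in `k` gives a collision.
  have hshift : ∀ c : Fin k, 𝔼 χ : Fin n → Fin k, (if χ u = χ w then (1 : ℝ) else 0) =
      𝔼 χ : Fin n → Fin k, (if c + χ u = χ w then (1 : ℝ) else 0) := by
    intro c
    refine (Fintype.expect_equiv (Equiv.piCongrRight fun v : Fin n =>
      if v = u then Equiv.addLeft c else Equiv.refl (Fin k)) _ _ fun χ => ?_).symm
    simp [h.symm]
  have h1 : 𝔼 _c : Fin k, 𝔼 χ : Fin n → Fin k, (if χ u = χ w then (1 : ℝ) else 0) =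
      𝔼 c : Fin k, 𝔼 χ : Fin n → Fin k, (if c + χ u = χ w then (1 : ℝ) else 0) :=
    Finset.expect_congr rfl fun c _ => hshift c
  rw [Fintype.expect_const, Finset.expect_comm] at h1
  rw [h1]
  have h2 : ∀ χ : Fin n → Fin k, 𝔼 c : Fin k, (if c + χ u = χ w then (1 : ℝ) else 0) = 1 / k := by
    intro χ
    rw [Fintype.expect_eq_sum_div_card, Fintype.card_fin]
    congr 1
    simp [← eq_sub_iff_add_eq]
  simp only [h2]
  exact Fintype.expect_const _

theorem bicolored_le_weight (E : List (Fin n × Fin n)) (χ : Fin n → ℕ) {o : Fin n → ℝ}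
    (ho : ∀ v, o v ∈ Set.Icc (0 : ℝ) 1) : bicolored E χ o ≤ weight E o := by
  refine List.sum_le_sum fun e _ => ?_
  have := mul_nonneg (ho e.1).1 (sub_nonneg.2 (ho e.2).2)
  split_ifs
  · exact this
  · exact le_rfl

theorem expect_weight_sub_bicolored {k : ℕ} (hk : 0 < k) (E : List (Fin n × Fin n))
    (hE : ∀ e ∈ E, e.1 ≠ e.2) (o : Fin n → ℝ) :
    𝔼 χ : Fin n → Fin k, (weight E o - bicolored E (fun v => χ v) o) = weight E o / k := by
  induction E with
  | nil => simp [weight, bicolored]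
  | cons e E ih =>
    have h1 : ∀ χ : Fin n → Fin k,
        weight (e :: E) o - bicolored (e :: E) (fun v => χ v) o =
          (if χ e.1 = χ e.2 then (1 : ℝ) else 0) * (o e.1 * (1 - o e.2)) +
            (weight E o - bicolored E (fun v => χ v) o) := by
      intro χ
      simp only [weight, bicolored, List.map_cons, List.sum_cons, ← Fin.ext_iff]
      split_ifs <;> ring
    have : Nonempty (Fin k) := ⟨⟨0, hk⟩⟩
    simp only [h1]
    rw [Finset.expect_add_distrib, ih fun x hx => hE x (by simp [hx]), ← Finset.expect_mul,
      expect_color_eq hk (hE e (by simp))]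
    simp only [weight, List.map_cons, List.sum_cons]
    ring

/-! ### The estimate for the value of the fractional cut -/

/-- The estimate for the value of the fractional cut, computed from a sampled tree. -/
noncomputable def valueEst (χ : Fin n → ℕ) (k : ℕ) (t : EdgeTree n D (k + 1)) : ℝ :=
  𝔼 i, (t.2 i).1.elim 0 fun e => est χ k e.1 (t.2 i).2.1 * (1 - est χ k e.2 (t.2 i).2.2)

theorem expect_valueEst_sub_sq_le {E : List (Fin n × Fin n)} (hE : E.length ≤ N)
    (h0 : 0 < E.length) (hD : 0 < D) (χ : Fin n → ℕ) (k : ℕ) :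
    𝔼 ω : TreeSeed N D (k + 1), (valueEst χ k (sample E (k + 1) (fun _ => true) ω) -
      weight E (frac N D E χ k) / E.length) ^ 2 ≤ 1 / D := by
  set A : Fin N.factorial × (TreeSeed N D k × TreeSeed N D k) → ℝ := fun x =>
    (slot E k (fun _ => true) x).1.elim 0 fun e =>
      est χ k e.1 (slot E k (fun _ => true) x).2.1 *
        (1 - est χ k e.2 (slot E k (fun _ => true) x).2.2) with hA
  have hA1 : ∀ x, |A x| ≤ 1 := fun x => by
    simp only [hA]
    cases (slot E k (fun _ => true) x).1 with
    | none => simp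
    | some e =>
      obtain ⟨h1, h2⟩ := est_mem_Icc χ k e.1 (slot E k (fun _ => true) x).2.1
      obtain ⟨h3, h4⟩ := est_mem_Icc χ k e.2 (slot E k (fun _ => true) x).2.2
      simp only [Option.elim]
      rw [abs_le]
      constructor <;> nlinarith
  have hEA : 𝔼 x, A x = weight E (frac N D E χ k) / E.length := by
    have := expect_slot hE k (fun _ => true) (by simpa using h0)
      (fun e s t => est χ k e.1 s * (1 - est χ k e.2 t))
      (fun e => frac N D E χ k e.1 * (1 - frac N D E χ k e.2)) fun e => by
        rw [Fintype.expect_mul_prod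
          (fun ω : TreeSeed N D k => est χ k e.1 (sample E k (touches (some e.1)) ω))
          (fun ω : TreeSeed N D k => 1 - est χ k e.2 (sample E k (touches (some e.2)) ω)),
          Finset.expect_sub_distrib, Fintype.expect_const]
        rfl
    simpa [weight] using this
  have := Fintype.expect_sampleMean_sub_sq_le A hA1 hD hEA
  rw [← Fintype.expect_comp_snd (α := TreeSeed N D k)] at this
  exact this

/-! ### The probability of a wrong output. -/

/-- The output on a sampled tree. -/
noncomputable def cutEst (η : ℝ) (χ : Fin n → ℕ) (k : ℕ) (t : EdgeTree n D (k + 1)) : ℝ :=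
  max (valueEst χ k t - η) 0

theorem cutEst_mem_Icc (G : DiMultigraph n) {E : List (Fin n × Fin n)}
    (hEG : (E : Multiset (Fin n × Fin n)) = G.edges) (hE : E.length ≤ N) (h0 : 0 < E.length)
    {H k : ℕ} (hH : 0 < H) {χ : Fin n → ℕ} (hχ : ∀ v, χ v < k) {ε η : ℝ} (hε : 0 < ε)
    (hη : 2 / H + 2 * η ≤ ε / 40) {o : Fin n → ℝ} (ho : ∀ v, o v = 0 ∨ o v = 1)
    (hopt : weight E o / E.length = G.maxval)
    (hloss : (weight E o - bicolored E χ o) / E.length ≤ 1.8 * ε * G.maxval)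
    {t : EdgeTree n D (k + 1)}
    (ht : |valueEst χ k t - weight E (frac N (H ^ 2) E χ k) / E.length| ≤ η) :
    cutEst η χ k t ∈ Set.Icc ((1 / 2 - ε) * G.maxval) G.maxval := by
  have h0' : (0 : ℝ) < E.length := by exact_mod_cast h0
  have hH' : (0 : ℝ) < H := by exact_mod_cast hH
  have hlo : ∀ e ∈ E, e.1 ≠ e.2 := fun e he => G.loopless e (by rw [← hEG]; simpa using he)
  have hF := G.weight_div_le_maxval hEG h0 (q := frac N (H ^ 2) E χ k)
    fun v => frac_mem_Icc E χ k v
  have hb := bicolored_le hE hlo hH χ hχ ho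
  have hq := G.quarter_le_maxval (by rw [← hEG]; simpa using h0)
  obtain ⟨h1, h2⟩ := abs_le.1 ht
  set F := weight E (frac N (H ^ 2) E χ k) / E.length with hFdef
  have hb' : bicolored E χ o / E.length ≤ 2 * F + 4 / H := by
    rw [div_le_iff₀ h0', hFdef]
    have : (2 * (weight E (frac N (H ^ 2) E χ k) / E.length) + 4 / H) * (E.length : ℝ) =
      2 * weight E (frac N (H ^ 2) E χ k) + 4 * E.length / H := by field_simp
    linarith
  rw [sub_div, hopt] at hloss
  have h4 : (4 : ℝ) / H = 2 * (2 / H) := by ring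
  refine ⟨le_trans ?_ (le_max_left _ _), max_le (by linarith) G.maxval_nonneg⟩
  -- The colouring costs `0.9 * ε * maxval`; the additive error `ε / 40` is at most `0.1 * ε *
  -- maxval` because `maxval ≥ 1 / 4`.
  nlinarith

theorem expect_bad_le (G : DiMultigraph n) {E : List (Fin n × Fin n)}
    (hEG : (E : Multiset (Fin n × Fin n)) = G.edges) (hE : E.length ≤ N)
    {H k : ℕ} (hH : 0 < H) (hk : 0 < k) {ε η : ℝ} (hε : 0 < ε) (hη0 : 0 < η)
    (hη : 2 / H + 2 * η ≤ ε / 40) {L : ℕ → List (Fin n × Fin n)} (hL : ∀ t, (L t).Perm E)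
    [∀ x : (Fin n → Fin k) × TreeSeed N (H ^ 2) (k + 1), Decidable (cutEst η (fun v => x.1 v) k
      (fill (k + 1) (fun _ => true) L x.2) ∈ Set.Icc ((1 / 2 - ε) * G.maxval) G.maxval)] :
    𝔼 x : (Fin n → Fin k) × TreeSeed N (H ^ 2) (k + 1),
      (if cutEst η (fun v => x.1 v) k (fill (k + 1) (fun _ => true) L x.2) ∈
        Set.Icc ((1 / 2 - ε) * G.maxval) G.maxval then (0 : ℝ) else 1) ≤
      1 / (1.8 * ε * k) + 1 / (H ^ 2 * η ^ 2) := by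
  have : Nonempty (Fin k) := ⟨⟨0, hk⟩⟩
  have hk' : (0 : ℝ) < k := by exact_mod_cast hk
  have hH' : (0 : ℝ) < H := by exact_mod_cast hH
  rcases Nat.eq_zero_or_pos E.length with h0 | h0
  · have hnil : E = [] := List.length_eq_zero_iff.1 h0
    have hmax : G.maxval = 0 := G.maxval_eq_zero (by rw [← hEG]; simpa using h0)
    have h1 : ∀ x : (Fin n → Fin k) × TreeSeed N (H ^ 2) (k + 1),
        cutEst η (fun v => x.1 v) k (fill (k + 1) (fun _ => true) L x.2) ∈
        Set.Icc ((1 / 2 - ε) * G.maxval) G.maxval := by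
      intro x
      have h2 : valueEst (fun v => x.1 v) k (fill (k + 1) (fun _ => true) L x.2) = 0 := by
        unfold valueEst
        refine Finset.expect_eq_zero fun i _ => ?_
        have : ((fill (k + 1) (fun _ => true) L x.2).2 i).1 = none := by
          have h3 : L 1 = [] := by
            rw [← List.length_eq_zero_iff, (hL 1).length_eq, h0]
          simp [fill, pick, h3]
        rw [this]; rfl
      rw [cutEst, h2, hmax]
      simp [hη0.le]
    simp only [h1, if_true]
    rw [Finset.expect_const_zero]
    positivity
  have h0' : (0 : ℝ) < E.length := by exact_mod_cast h0
  have hlo : ∀ e ∈ E, e.1 ≠ e.2 := fun e he => G.loopless e (by rw [← hEG]; simpa using he)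
  have hq := G.quarter_le_maxval (by rw [← hEG]; simpa using h0)
  obtain ⟨σ, hσ⟩ := exists_equiv_fill (D := H ^ 2) hE (k + 1) (fun _ => true) (fun _ => .refl E) hL
  obtain ⟨x₀, hx₀⟩ := G.exists_cutValue_eq_maxval
  rw [cutValue_eq G hEG] at hx₀
  set o : Fin n → ℝ := fun v => if x₀ v then 1 else 0 with hodef
  have ho : ∀ v, o v = 0 ∨ o v = 1 := fun v => by
    simp only [hodef]; split_ifs <;> simp
  have ho' : ∀ v, o v ∈ Set.Icc (0 : ℝ) 1 := fun v => by
    rcases ho v with h | h <;> simp [h]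
  set f : (Fin n → Fin k) → ℝ := fun χ =>
    (weight E o - bicolored E (fun v => χ v) o) * (1 / (E.length * (1.8 * ε * G.maxval))) with hf
  set g : (Fin n → Fin k) → TreeSeed N (H ^ 2) (k + 1) → ℝ := fun χ ω =>
    (valueEst (fun v => χ v) k (sample E (k + 1) (fun _ => true) ω) -
      weight E (frac N (H ^ 2) E (fun v => χ v) k) / E.length) ^ 2 * (1 / η ^ 2) with hg
  have hMpos : 0 < G.maxval := by linarith
  have hf0 : ∀ χ, 0 ≤ f χ := fun χ =>
    mul_nonneg (sub_nonneg.2 (bicolored_le_weight E _ ho')) (by positivity)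
  have hg0 : ∀ χ ω, 0 ≤ g χ ω := fun χ ω => by positivity
  -- Markov for the colouring loss and Chebyshev for the sampling error: if both `f` and `g` are at
  -- most `1`, the output is good. The bijection `σ` moves the given passes to constant ones.
  have hpt : ∀ x : (Fin n → Fin k) × TreeSeed N (H ^ 2) (k + 1),
      (if cutEst η (fun v => x.1 v) k (fill (k + 1) (fun _ => true) L x.2) ∈
        Set.Icc ((1 / 2 - ε) * G.maxval) G.maxval then (0 : ℝ) else 1) ≤ f x.1 + g x.1 (σ x.2) := by
    intro x
    split_ifs with hgood
    · exact add_nonneg (hf0 _) (hg0 _ _)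
    · by_contra! hlt
      apply hgood
      have hf1 : f x.1 ≤ 1 := by linarith [hg0 x.1 (σ x.2)]
      have hg1 : g x.1 (σ x.2) ≤ 1 := by linarith [hf0 x.1]
      rw [← hσ]
      refine G.cutEst_mem_Icc hEG hE h0 hH (fun v => (x.1 v).2) hε hη ho hx₀ ?_ ?_
      · simp only [hf] at hf1
        rw [mul_one_div, div_le_one (by positivity)] at hf1
        rw [div_le_iff₀ h0']
        linarith
      · simp only [hg] at hg1
        rw [mul_one_div, div_le_one (by positivity)] at hg1
        exact abs_le_of_sq_le_sq hg1 hη0.le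
  refine (Finset.expect_le_expect fun x _ => hpt x).trans ?_
  rw [Finset.expect_add_distrib, Fintype.expect_comp_fst]
  refine add_le_add (le_of_eq ?_) ?_
  · simp only [hf]
    rw [← Finset.expect_mul, expect_weight_sub_bicolored hk E hlo]
    rw [div_eq_iff h0'.ne'] at hx₀
    rw [hx₀]
    field_simp
  · rw [Fintype.expect_prod]
    refine Finset.expect_le Finset.univ_nonempty fun χ _ => ?_
    rw [Fintype.expect_equiv σ (fun ω => g χ (σ ω)) (g χ) fun _ => rfl]
    simp only [hg]
    rw [← Finset.expect_mul]
    have := expect_valueEst_sub_sq_le hE h0 (pow_pos hH 2) (fun v => (χ v : ℕ)) k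
    push_cast at this
    calc _ ≤ 1 / (H : ℝ) ^ 2 * (1 / η ^ 2) := by gcongr
      _ = _ := by rw [one_div_mul_one_div]

end DiMultigraph

/-! ### The streaming algorithm with a fixed list of seeds. -/

namespace Sampler

open DiMultigraph

variable {n N D : ℕ}

/-- The streaming algorithm that draws one of `T` fixed seeds and samples a tree with it. -/
noncomputable def algorithm (n N D k T : ℕ) [NeZero T] (η : ℝ)
    (s : Fin T → (Fin n → Fin k) × TreeSeed N D (k + 1)) : StreamingAlgorithm n where
  State := Fin T × Fin (2 * (k + 1) + 1) × Tower (Cell n N) D (k + 1)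
  passes := 2 * (k + 1)
  init := (PMF.uniformOfFintype (Fin T)).map fun i => (i, 0, Tower.const (none, 0) (k + 1))
  step σ e := PMF.pure (σ.1, σ.2.1, step (k + 1) (fun _ => true) σ.2.1 σ.2.2 e)
  endPass σ := PMF.pure (σ.1, σ.2.1 + 1, finish (k + 1) (s σ.1).2 σ.2.1 σ.2.2)
  output σ := cutEst η (fun v => (s σ.1).1 v) k (σ.2.2.map Prod.fst)

section

variable {k T : ℕ} [NeZero T] {η : ℝ} (s : Fin T → (Fin n → Fin k) × TreeSeed N D (k + 1))

theorem algorithm_readEdges (l : List (Fin n × Fin n)) (i : Fin T) (t : Fin (2 * (k + 1) + 1))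
    (m : Tower (Cell n N) D (k + 1)) :
    (algorithm n N D k T η s).readEdges l (i, t, m) =
      PMF.pure (i, t, l.foldl (step (k + 1) (fun _ => true) t) m) := by
  induction l generalizing m with
  | nil => rfl
  | cons e l ih =>
    exact (PMF.pure_bind _ _).trans (ih _)

theorem algorithm_readPasses (E : List (Fin n × Fin n)) (ps : List (List (Fin n × Fin n)))
    (i : Fin T) (t : Fin (2 * (k + 1) + 1)) (m : Tower (Cell n N) D (k + 1))
    (h : t + ps.length ≤ 2 * (k + 1)) :
    ∃ t', (algorithm n N D k T η s).readPasses ps (i, t, m) =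
      PMF.pure (i, t', run (k + 1) (fun _ => true) (s i).2 t ps.length
        (fun u => ps.getD u E) m) := by
  induction ps generalizing t m with
  | nil => exact ⟨t, rfl⟩
  | cons p ps ih =>
    rw [List.length_cons] at h
    have ht : ((t + 1 : Fin (2 * (k + 1) + 1)) : ℕ) = t + 1 := by
      rw [Fin.val_add_one_of_lt' (by omega)]
    obtain ⟨t', ht'⟩ := ih (t + 1) (finish (k + 1) (s i).2 t
      (p.foldl (step (k + 1) (fun _ => true) t) m)) (by rw [ht]; omega)
    refine ⟨t', ?_⟩
    have h1 := algorithm_readEdges (η := η) s p i t m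
    have h2 : ((algorithm n N D k T η s).readEdges p (i, t, m)).bind
        (algorithm n N D k T η s).endPass = PMF.pure (i, t + 1, finish (k + 1) (s i).2 t
          (p.foldl (step (k + 1) (fun _ => true) t) m)) :=
      (congrArg (fun μ => PMF.bind μ (algorithm n N D k T η s).endPass) h1).trans
        (PMF.pure_bind _ _)
    refine (congrArg (fun μ => PMF.bind μ ((algorithm n N D k T η s).readPasses ps)) h2).trans ?_
    refine (PMF.pure_bind _ _).trans (ht'.trans ?_)
    rw [ht]
    rfl

theorem algorithm_outputDist {E : List (Fin n × Fin n)} (hE : E.length ≤ N)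
    (ps : List (List (Fin n × Fin n))) (hps : ps.length = 2 * (k + 1))
    (hperm : ∀ p ∈ ps, p.Perm E) :
    (algorithm n N D k T η s).outputDist ps = (PMF.uniformOfFintype (Fin T)).map fun i =>
      cutEst η (fun v => (s i).1 v) k
        (fill (k + 1) (fun _ => true) (fun t => ps.getD t E) (s i).2) := by
  have hL : ∀ t, (ps.getD t E).Perm E := by
    intro t
    rcases lt_or_ge t ps.length with h | h
    · rw [List.getD_eq_getElem _ _ h]; exact hperm _ (List.getElem_mem h)
    · rw [List.getD_eq_default _ _ h]
  have h1 : ∀ i : Fin T, ((algorithm n N D k T η s).readPasses ps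
      (i, 0, Tower.const (none, 0) (k + 1))).map (algorithm n N D k T η s).output =
      PMF.pure (cutEst η (fun v => (s i).1 v) k
        (fill (k + 1) (fun _ => true) (fun t => ps.getD t E) (s i).2)) := by
    intro i
    obtain ⟨t', ht'⟩ := algorithm_readPasses (η := η) s E ps i 0 (Tower.const (none, 0) (k + 1))
      (by simp [hps])
    rw [hps] at ht'
    refine (congrArg (PMF.map (algorithm n N D k T η s).output) ht').trans ?_
    refine (PMF.pure_map _ _).trans ?_
    rw [← map_run_const (k + 1) (fun _ => true) (s i).2 _ hE hL]
    rfl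
  unfold StreamingAlgorithm.outputDist
  rw [PMF.map_bind]
  refine (PMF.bind_map _ _ _).trans ?_
  refine (congrArg (PMF.bind _) (funext h1)).trans ?_
  exact PMF.bind_pure_comp _ _

end

theorem _root_.PMF.le_toMeasure_map_uniform {T : ℕ} [NeZero T] (f : Fin T → ℝ) {S : Set ℝ}
    (hS : MeasurableSet S) [∀ i, Decidable (f i ∉ S)]
    (h : 10 * (Finset.univ.filter fun i => f i ∉ S).card ≤ T) :
    9 / 10 ≤ ((PMF.uniformOfFintype (Fin T)).map f).toMeasure S := by
  classical
  rw [PMF.toMeasure_map_apply f _ S (measurable_of_finite f) hS,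
    PMF.toMeasure_uniformOfFintype_apply _ (Set.toFinite _).measurableSet, Fintype.card_fin]
  have h1 : Fintype.card (f ⁻¹' S) = (Finset.univ.filter fun i => f i ∈ S).card := by
    rw [Fintype.card_subtype]; rfl
  have h2 := Finset.card_filter_add_card_filter_not (s := (Finset.univ : Finset (Fin T)))
    (fun i => f i ∈ S)
  rw [Finset.card_univ, Fintype.card_fin] at h2
  have hT : (T : ENNReal) ≠ 0 := by exact_mod_cast NeZero.ne T
  rw [h1, ENNReal.le_div_iff_mul_le (Or.inl hT) (Or.inl (ENNReal.natCast_ne_top T)), mul_comm, ← mul_div_assoc]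
  refine ENNReal.div_le_of_le_mul ?_
  have h3 : T * 9 ≤ (Finset.univ.filter fun i => f i ∈ S).card * 10 := by
    have : (Finset.univ.filter fun i => f i ∉ S).card =
      (Finset.univ.filter fun i => ¬ f i ∈ S).card := by congr
    omega
  exact_mod_cast h3

theorem _root_.List.reduceOption_ofFn_getElem? {α : Type*} (N : ℕ) (l : List α)
    (h : l.length ≤ N) : (List.ofFn fun i : Fin N => l[(i : ℕ)]?).reduceOption = l := by
  induction N generalizing l with
  | zero =>
    have : l = [] := List.length_eq_zero_iff.1 (by omega)
    simp [this]
  | succ N ih =>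
    rw [List.ofFn_succ]
    cases l with
    | nil => simp
    | cons a l =>
      have := ih l (by simpa using h)
      simpa using this

/-- The passes that are described by a table. -/
def decode {P : ℕ} (b : Fin P → Fin N → Option (Fin n × Fin n)) : List (List (Fin n × Fin n)) :=
  List.ofFn fun t => (List.ofFn (b t)).reduceOption

theorem exists_decode_eq {P : ℕ} (ps : List (List (Fin n × Fin n))) (hP : ps.length = P)
    (hN : ∀ p ∈ ps, p.length ≤ N) :
    ∃ b : Fin P → Fin N → Option (Fin n × Fin n), decode b = ps := by
  subst hP
  refine ⟨fun t i => (ps.get t)[(i : ℕ)]?, ?_⟩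
  unfold decode
  conv_rhs => rw [← List.ofFn_get ps]
  congr 1
  funext t
  exact List.reduceOption_ofFn_getElem? N _ (hN _ (List.get_mem _ _))

/-- A table records the order of every pass, so the union bound covers the adversarial orders along
with the graphs. -/
theorem card_tables_lt (n N P : ℕ) :
    Fintype.card (Fin P → Fin N → Option (Fin n × Fin n)) < 2 ^ (n ^ 2 * N * P + 1) := by
  simp only [Fintype.card_fun, Fintype.card_option, Fintype.card_prod, Fintype.card_fin]
  have h : n * n + 1 ≤ 2 ^ (n ^ 2) := by
    rw [← sq]; exact Nat.lt_two_pow_self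
  calc ((n * n + 1) ^ N) ^ P ≤ ((2 ^ n ^ 2) ^ N) ^ P := by gcongr
    _ = 2 ^ (n ^ 2 * N * P) := by rw [← pow_mul, ← pow_mul, mul_assoc]
    _ < _ := Nat.pow_lt_pow_right (by norm_num) (Nat.lt_succ_self _)

/-- There is a streaming algorithm with the required guarantee. -/
theorem exists_algorithm (n N : ℕ) {H k : ℕ} (hH : 0 < H) (hk : 0 < k) {ε η : ℝ} (hε : 0 < ε)
    (hη0 : 0 < η) (hη : 2 / H + 2 * η ≤ ε / 40)
    (hbad : 1 / (1.8 * ε * k) + 1 / (H ^ 2 * η ^ 2) ≤ 1 / 40) :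
    ∃ A : StreamingAlgorithm n, A.passes = 2 * (k + 1) ∧
      Fintype.card A.State = 25 * (n ^ 2 * N * (2 * (k + 1)) + 1) * ((2 * (k + 1) + 1) *
        Fintype.card (Tower (Cell n N) (H ^ 2) (k + 1))) ∧
      ∀ G : DiMultigraph n, Multiset.card G.edges ≤ N →
        ∀ ps : List (List (Fin n × Fin n)), ps.length = A.passes →
          (∀ p ∈ ps, (p : Multiset (Fin n × Fin n)) = G.edges) →
          9 / 10 ≤ (A.outputDist ps).toMeasure
            (Set.Icc ((1 / 2 - ε) * G.maxval) G.maxval) := by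
  classical
  have : Nonempty (Fin k) := ⟨⟨0, hk⟩⟩
  let bad : (Fin (2 * (k + 1)) → Fin N → Option (Fin n × Fin n)) →
      (Fin n → Fin k) × TreeSeed N (H ^ 2) (k + 1) → Prop := fun b x =>
    ∃ G : DiMultigraph n, Multiset.card G.edges ≤ N ∧
      (∀ p ∈ decode b, (p : Multiset (Fin n × Fin n)) = G.edges) ∧
      cutEst η (fun v => x.1 v) k
        (fill (k + 1) (fun _ => true) (fun t => (decode b).getD t G.edges.toList) x.2) ∉
        Set.Icc ((1 / 2 - ε) * G.maxval) G.maxval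
  have hbad' : ∀ b, 𝔼 x, (if bad b x then (1 : ℝ) else 0) ≤ 1 / 40 := by
    intro b
    by_cases hG : ∃ G : DiMultigraph n, Multiset.card G.edges ≤ N ∧
      (∀ p ∈ decode b, (p : Multiset (Fin n × Fin n)) = G.edges)
    · obtain ⟨G, hN, hp⟩ := hG
      have hEG : (G.edges.toList : Multiset (Fin n × Fin n)) = G.edges := Multiset.coe_toList _
      have hL : ∀ t, ((decode b).getD t G.edges.toList).Perm G.edges.toList := by
        intro t
        rcases lt_or_ge t (decode b).length with h | h
        · rw [List.getD_eq_getElem _ _ h, ← Multiset.coe_eq_coe, hEG]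
          exact hp _ (List.getElem_mem h)
        · rw [List.getD_eq_default _ _ h]
      have := G.expect_bad_le hEG (N := N) (by simpa using hN) hH hk hε hη0 hη hL
      refine le_trans (Finset.expect_le_expect fun x _ => ?_) (this.trans hbad)
      by_cases hb : bad b x
      · rw [if_pos hb, if_neg]
        obtain ⟨G', _, hp', hout⟩ := hb
        -- There is at least one pass, and any pass determines the graph.
        have hmem : (decode b)[0]'(by simp [decode]) ∈ decode b := List.getElem_mem _
        have hGG : G' = G := by
          have := (hp' _ hmem).symm.trans (hp _ hmem)
          cases G; cases G'; simpa using this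
        rw [hGG] at hout
        exact hout
      · rw [if_neg hb]
        split_ifs <;> norm_num
    · have : ∀ x, ¬ bad b x := fun x ⟨G, h1, h2, _⟩ => hG ⟨G, h1, h2⟩
      simp only [this, if_false, Finset.expect_const_zero]
      norm_num
  obtain ⟨s, hs⟩ := exists_seeds_card_bad_le bad hbad' _ (card_tables_lt n N (2 * (k + 1)))
  have : NeZero (25 * (n ^ 2 * N * (2 * (k + 1)) + 1)) := ⟨by positivity⟩
  refine ⟨algorithm n N (H ^ 2) k _ η s, rfl, ?_, fun G hN ps hlen hps => ?_⟩
  · have : Fintype.card (algorithm n N (H ^ 2) k _ η s).State =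
      Fintype.card (Fin (25 * (n ^ 2 * N * (2 * (k + 1)) + 1)) × Fin (2 * (k + 1) + 1) ×
        Tower (Cell n N) (H ^ 2) (k + 1)) := rfl
    rw [this]
    simp only [Fintype.card_prod, Fintype.card_fin]
  · have hEG : (G.edges.toList : Multiset (Fin n × Fin n)) = G.edges := Multiset.coe_toList _
    have hlen' : ps.length = 2 * (k + 1) := hlen
    rw [algorithm_outputDist s (E := G.edges.toList) (by simpa using hN) ps hlen' fun p hp => by
      rw [← Multiset.coe_eq_coe, hEG]; exact hps p hp]
    refine PMF.le_toMeasure_map_uniform _ measurableSet_Icc ?_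
    obtain ⟨b, hb⟩ := exists_decode_eq (N := N) ps hlen' fun p hp => by
      rw [← Multiset.coe_card, hps p hp]; exact hN
    refine le_trans (Nat.mul_le_mul_left _ (Finset.card_le_card ?_)) (hs b)
    intro i hi
    simp only [Finset.mem_filter, Finset.mem_univ, true_and] at hi ⊢
    refine ⟨G, hN, by rw [hb]; exact hps, ?_⟩
    rw [hb]
    exact hi

end Sampler

/-! ### Space bounds and the choice of parameters. -/

namespace StreamingAlgorithm

/-- The algorithm that reads nothing and outputs `0`. -/
noncomputable def zero (n : ℕ) : StreamingAlgorithm n where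
  State := Unit
  passes := 0
  init := PMF.pure ()
  step _ _ := PMF.pure ()
  endPass _ := PMF.pure ()
  output _ := 0

theorem zero_outputDist (n : ℕ) : (zero n).outputDist [] = PMF.pure 0 := by
  have h : (zero n).readPasses [] = PMF.pure := rfl
  rw [outputDist, h, PMF.bind_pure]
  exact PMF.pure_map _ _

theorem space_zero (n : ℕ) : (zero n).space = 0 := by
  have : Fintype.card (zero n).State = 1 := Fintype.card_unit
  rw [space, this, Nat.clog_one_right]

theorem space_le {n W : ℕ} (A : StreamingAlgorithm n) (h : Fintype.card A.State ≤ n ^ W) :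
    A.space ≤ Nat.clog 2 n * W := by
  refine Nat.clog_le_of_le_pow (h.trans ?_)
  rw [pow_mul]
  exact Nat.pow_le_pow_left (Nat.le_pow_clog (by norm_num) n) W

end StreamingAlgorithm

theorem clog_two_le_log {n : ℕ} (hn : 2 ≤ n) : (Nat.clog 2 n : ℝ) ≤ 3 * Real.log n := by
  have h1 : 2 ^ (Nat.clog 2 n - 1) ≤ n := by
    have := Nat.pow_pred_clog_lt_self (b := 2) (by norm_num) (x := n) (by omega)
    exact this.le
  have h0 : 0 < Nat.clog 2 n := Nat.clog_pos (by norm_num) hn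
  have h2 : ((Nat.clog 2 n - 1 : ℕ) : ℝ) * Real.log 2 ≤ Real.log n := by
    rw [← Real.log_pow]
    exact Real.log_le_log (by positivity) (by exact_mod_cast h1)
  rw [Nat.cast_sub h0, Nat.cast_one] at h2
  have h3 : Real.log 2 ≤ Real.log n := Real.log_le_log (by norm_num) (by exact_mod_cast hn)
  have h4 := Real.log_two_gt_d9
  have h5 : (0 : ℝ) ≤ Nat.clog 2 n := by positivity
  nlinarith

theorem Sampler.card_state_le {n K k : ℕ} (hn : 2 ≤ n) (hK : 1000 ≤ K) (hk : k + 1 ≤ 100 * K) :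
    ∃ W, 3 * W ≤ K ^ (501 * K) ∧
      25 * (n ^ 2 * n ^ K * (2 * (k + 1)) + 1) * ((2 * (k + 1) + 1) *
        Fintype.card (Tower (Sampler.Cell n (n ^ K)) ((K ^ 2) ^ 2) (k + 1))) ≤ n ^ W := by
  have hn0 : 0 < n := by omega
  set P := 2 * (k + 1) with hP
  have hP1 : P + 1 ≤ n ^ P :=
    (Nat.lt_two_pow_self (n := P)).trans_le (Nat.pow_le_pow_left hn P)
  have h25 : 25 ≤ n ^ 5 := le_trans (by norm_num) (Nat.pow_le_pow_left hn 5)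
  have hT : n ^ 2 * n ^ K * P + 1 ≤ n ^ (2 + K) * n ^ P := by
    calc n ^ 2 * n ^ K * P + 1 ≤ n ^ (2 + K) * P + n ^ (2 + K) := by
          rw [pow_add]
          have : 0 < n ^ 2 * n ^ K := by positivity
          omega
      _ = n ^ (2 + K) * (P + 1) := by ring
      _ ≤ _ := Nat.mul_le_mul_left _ hP1
  have hcell : Fintype.card (Sampler.Cell n (n ^ K)) ≤ n ^ (K + 4) := by
    simp only [Sampler.Cell, Fintype.card_prod, Fintype.card_option, Fintype.card_fin]
    have h1 : n * n + 1 ≤ n ^ 3 := by nlinarith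
    have h2 : n ^ K + 1 ≤ n ^ (K + 1) := by
      rw [pow_succ]
      have : 0 < n ^ K := by positivity
      nlinarith
    calc _ ≤ n ^ 3 * n ^ (K + 1) := Nat.mul_le_mul h1 h2
      _ = _ := by ring
  have htower := Tower.card_le (D := (K ^ 2) ^ 2) hn0 hcell (k + 1)
  have hD : 2 * (K ^ 2) ^ 2 + 1 ≤ K ^ 5 := by
    have : 0 < K ^ 4 := by positivity
    calc 2 * (K ^ 2) ^ 2 + 1 = 2 * K ^ 4 + 1 := by ring
      _ ≤ K * K ^ 4 := by nlinarith
      _ = _ := by ring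
  -- The tower contributes the dominant exponent: the branching is at most `K ^ 5` and the depth at
  -- most `100 * K`.
  have hDk : (2 * (K ^ 2) ^ 2 + 1) ^ (k + 1) ≤ K ^ (500 * K) := by
    calc _ ≤ (K ^ 5) ^ (k + 1) := Nat.pow_le_pow_left hD _
      _ = K ^ (5 * (k + 1)) := by rw [← pow_mul]
      _ ≤ _ := Nat.pow_le_pow_right (by omega) (by omega)
  refine ⟨5 + (2 + K + P) + P + (K + 4) * K ^ (500 * K), ?_, ?_⟩
  · have h1 : K ≤ K ^ (500 * K) := Nat.le_self_pow (by omega) K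
    set X := K ^ (500 * K) with hX
    have h2 : X * K ^ 2 ≤ K ^ (501 * K) := by
      rw [hX, ← pow_add]
      exact Nat.pow_le_pow_right (by omega) (by omega)
    refine le_trans ?_ h2
    have h3 : 5 + (2 + K + P) + P ≤ 402 * X := by omega
    calc 3 * (5 + (2 + K + P) + P + (K + 4) * X) ≤ 3 * (402 * X + (K + 4) * X) := by gcongr
      _ = X * (1218 + 3 * K) := by ring
      _ ≤ X * K ^ 2 := Nat.mul_le_mul_left _ (by nlinarith)
  · calc _ ≤ n ^ 5 * (n ^ (2 + K) * n ^ P) * (n ^ P * n ^ ((K + 4) * K ^ (500 * K))) := by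
          refine Nat.mul_le_mul (Nat.mul_le_mul h25 hT) (Nat.mul_le_mul hP1 (htower.trans ?_))
          exact Nat.pow_le_pow_right hn0 (Nat.mul_le_mul_left _ hDk)
      _ = _ := by ring

theorem natCast_pow_le_rpow {ε : ℝ} (hε : 0 < ε) (hε1 : ε < 1 / 10000) {K : ℕ}
    (hK : (K : ℝ) ≤ 2 / ε) : ((K ^ (501 * K) : ℕ) : ℝ) ≤ ε ^ (-(10 ^ 5 : ℝ) / ε) := by
  rcases Nat.eq_zero_or_pos K with rfl | hK0
  · have h0 : (1 : ℝ) ≤ ε ^ (-(10 ^ 5 : ℝ) / ε) :=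
      Real.one_le_rpow_of_pos_of_le_one_of_nonpos hε (by linarith)
        (div_nonpos_of_nonpos_of_nonneg (by norm_num) hε.le)
    simpa using h0
  have hK1 : (1 : ℝ) ≤ K := by exact_mod_cast hK0
  have h1 : (K : ℝ) ≤ ε ^ (-2 : ℝ) := by
    refine hK.trans ?_
    rw [Real.rpow_neg hε.le, Real.rpow_two, div_le_iff₀ hε]
    field_simp
    linarith
  calc ((K ^ (501 * K) : ℕ) : ℝ) = (K : ℝ) ^ ((501 * K : ℕ) : ℝ) := by
        rw [Real.rpow_natCast]; push_cast; rfl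
    _ ≤ (K : ℝ) ^ (1002 / ε) := by
        refine Real.rpow_le_rpow_of_exponent_le hK1 ?_
        push_cast
        calc (501 : ℝ) * K ≤ 501 * (2 / ε) := by gcongr
          _ = 1002 / ε := by ring
    _ ≤ (ε ^ (-2 : ℝ)) ^ (1002 / ε) := by
        exact Real.rpow_le_rpow (by linarith) h1 (by positivity)
    _ = ε ^ (-2 * (1002 / ε)) := by rw [← Real.rpow_mul hε.le]
    _ ≤ ε ^ (-(10 ^ 5 : ℝ) / ε) := by
        refine Real.rpow_le_rpow_of_exponent_ge hε (by linarith) ?_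
        rw [show -2 * (1002 / ε) = (-2004) / ε by ring]
        gcongr
        norm_num

theorem mainTheorem3 :
    ∃ ε₀ : ℝ, 0 < ε₀ ∧ ∀ ε : ℝ, 0 < ε → ε < ε₀ →
      ∃ A : (n : ℕ) → StreamingAlgorithm n, ∀ n : ℕ,
        ((A n).passes : ℝ) ≤ 200 / ε ∧
        ((A n).space : ℝ) ≤ ε ^ (-(10 ^ 5 : ℝ) / ε) * Real.log n ∧
        ∀ G : DiMultigraph n, (Multiset.card G.edges : ℝ) ≤ (n : ℝ) ^ (1 / ε) →
          ∀ ps : List (List (Fin n × Fin n)), ps.length = (A n).passes →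
            (∀ p ∈ ps, (p : Multiset (Fin n × Fin n)) = G.edges) →
            9 / 10 ≤ ((A n).outputDist ps).toMeasure
              (Set.Icc ((1 / 2 - ε) * G.maxval) G.maxval) := by
  refine ⟨1 / 10000, by norm_num, fun ε hε hε1 => ?_⟩
  rw [← Classical.skolem (p := fun n (A : StreamingAlgorithm n) =>
        (A.passes : ℝ) ≤ 200 / ε ∧
        (A.space : ℝ) ≤ ε ^ (-(10 ^ 5 : ℝ) / ε) * Real.log n ∧
        ∀ G : DiMultigraph n, (Multiset.card G.edges : ℝ) ≤ (n : ℝ) ^ (1 / ε) →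
          ∀ ps : List (List (Fin n × Fin n)), ps.length = A.passes →
            (∀ p ∈ ps, (p : Multiset (Fin n × Fin n)) = G.edges) →
            9 / 10 ≤ (A.outputDist ps).toMeasure
              (Set.Icc ((1 / 2 - ε) * G.maxval) G.maxval))]
  intro n
  rcases Nat.lt_or_ge n 2 with hn | hn
  -- Here `log n = 0` leaves no space at all, but a loopless graph on at most one vertex has no
  -- edges.
  · refine ⟨StreamingAlgorithm.zero n, ?_, ?_, fun G _ ps hps _ => ?_⟩
    · have : (StreamingAlgorithm.zero n).passes = 0 := rfl
      rw [this, Nat.cast_zero]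
      positivity
    · rw [StreamingAlgorithm.space_zero]
      have : Real.log n = 0 := by interval_cases n <;> simp
      simp [this]
    · have hps' : ps = [] := List.length_eq_zero_iff.1 hps
      have hcard : Multiset.card G.edges = 0 := by
        rw [Multiset.card_eq_zero]
        refine Multiset.eq_zero_of_forall_notMem fun e he => G.loopless e he ?_
        have h1 := e.1.2
        have h2 := e.2.2
        exact Fin.ext (by omega)
      have h0 : (0 : ℝ) ∈ Set.Icc ((1 / 2 - ε) * G.maxval) G.maxval := by
        simp [G.maxval_eq_zero hcard]
      rw [hps', StreamingAlgorithm.zero_outputDist, PMF.toMeasure_pure,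
        MeasureTheory.Measure.dirac_apply_of_mem h0]
      exact ENNReal.div_le_of_le_mul (by norm_num)
  -- The edge bound is `n ^ K`. Taking `99 / ε` colours leaves room for the extra level of the value
  -- estimate: `2 * (k + 1) ≤ 200 / ε`.
  · set K := ⌈1 / ε⌉₊ with hKdef
    set k := ⌊99 / ε⌋₊ with hkdef
    have hinv : 10000 ≤ 1 / ε := by
      rw [le_div_iff₀ hε]; linarith
    have hK1 : 1 / ε ≤ K := Nat.le_ceil _
    have hK2 : (K : ℝ) ≤ 2 / ε := by
      have := (Nat.ceil_lt_add_one (by positivity : 0 ≤ 1 / ε)).le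
      have h2 : 2 / ε = 1 / ε + 1 / ε := by ring
      linarith
    have hKε : 1 ≤ K * ε := by rwa [div_le_iff₀ hε] at hK1
    have hK3 : 1000 ≤ K := by
      have : (1000 : ℝ) ≤ K := by linarith
      exact_mod_cast this
    have hk1 : (k : ℝ) ≤ 99 / ε := Nat.floor_le (by positivity)
    have hk2 : 99 / ε - 1 < k := Nat.sub_one_lt_floor _
    have h99 : 99 / ε = 99 * (1 / ε) := by ring
    have hkε : 98 ≤ ε * k := by
      have h1 : ε * (99 / ε - 1) = 99 - ε := by field_simp
      nlinarith
    have hkpos : 0 < k := by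
      rcases Nat.eq_zero_or_pos k with h | h
      · rw [h] at hkε; norm_num at hkε
      · exact h
    have hk3 : k + 1 ≤ 100 * K := by
      have : (k : ℝ) + 1 ≤ 100 * K := by linarith
      exact_mod_cast this
    have hKpos : (0 : ℝ) < K := by linarith
    have hKsq : 1 / (K : ℝ) ^ 2 ≤ ε ^ 2 := by
      rw [div_le_iff₀ (by positivity), ← mul_pow]
      exact one_le_pow₀ (by linarith)
    have hη : 2 / ((K ^ 2 : ℕ) : ℝ) + 2 * (ε / 200) ≤ ε / 40 := by
      push_cast
      have : (2 : ℝ) / (K : ℝ) ^ 2 = 2 * (1 / (K : ℝ) ^ 2) := by ring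
      rw [this]
      nlinarith
    -- With `H = K ^ 2` and `η = ε / 200` the Chebyshev denominator is at least `K ^ 2 / 40000`; `H
    -- = K` would not suffice for `1 / 40`.
    have hbad : 1 / (1.8 * ε * k) + 1 / (((K ^ 2 : ℕ) : ℝ) ^ 2 * (ε / 200) ^ 2) ≤ 1 / 40 := by
      have h1 : 1 / (1.8 * ε * k) ≤ 1 / 100 := by
        apply one_div_le_one_div_of_le (by norm_num)
        nlinarith
      have h2 : 1 / (((K ^ 2 : ℕ) : ℝ) ^ 2 * (ε / 200) ^ 2) ≤ 1 / 100 := by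
        apply one_div_le_one_div_of_le (by norm_num)
        push_cast
        have h3 : ((K : ℝ) ^ 2) ^ 2 * (ε / 200) ^ 2 = (K * ε) ^ 2 * (K : ℝ) ^ 2 / 40000 := by ring
        have h4 : (1 : ℝ) ≤ (K * ε) ^ 2 := one_le_pow₀ hKε
        have h5 : (10000 : ℝ) ^ 2 ≤ (K : ℝ) ^ 2 := by gcongr; linarith
        rw [h3]
        nlinarith
      linarith
    obtain ⟨A, hpass, hcard, hA⟩ := Sampler.exists_algorithm n (n ^ K) (H := K ^ 2)
      (pow_pos (by omega) 2) hkpos hε (by positivity : 0 < ε / 200) hη hbad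
    refine ⟨A, ?_, ?_, fun G hG => hA G ?_⟩
    · rw [hpass]
      push_cast
      have : 200 / ε = 200 * (1 / ε) := by ring
      linarith
    · obtain ⟨W, hW, hle⟩ := Sampler.card_state_le hn hK3 hk3
      have hs := A.space_le (hcard.trans_le hle)
      have hlog := clog_two_le_log hn
      have hW' : (3 : ℝ) * W ≤ ε ^ (-(10 ^ 5 : ℝ) / ε) :=
        le_trans (by exact_mod_cast hW) (natCast_pow_le_rpow hε hε1 hK2)
      have hlog0 : 0 ≤ Real.log n := Real.log_natCast_nonneg n
      calc (A.space : ℝ) ≤ Nat.clog 2 n * W := by exact_mod_cast hs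
        _ ≤ 3 * Real.log n * W := by gcongr
        _ = 3 * W * Real.log n := by ring
        _ ≤ _ := by gcongr
    · have h1 : (n : ℝ) ^ (1 / ε) ≤ (n : ℝ) ^ (K : ℝ) :=
        Real.rpow_le_rpow_of_exponent_le (by exact_mod_cast (by omega : 1 ≤ n)) hK1
      rw [Real.rpow_natCast] at h1
      exact_mod_cast hG.trans h1
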